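/- Let $d\ge 1$, let $A\in\mathbb R^{d\times d}$ be regular, $\Lambda=A\mathbb Z^d$, $\Lambda^*=A^{-T}\mathbb Z^d$, $V_\Lambda=|\det A|$; write $\mathbb N_0=\{0,1,2,\dots\}$ and $\bm y^2=\bm y\cdot\bm y=|\bm y|^2$. Let $Z_{\Lambda,\nu}(\bm x,\bm y)$ denote the Epstein zeta function, i.e. the meromorphic continuation to $\nu\in\mathbb C$ of $$\sum_{\bm z\in\Lambda,\ \bm z\ne\bm x}\frac{e^{-2\pi i\bm y\cdot\bm z}}{|\bm x-\bm z|^{\nu}},\qquad \operatorname{Re}\nu>d .$$ For $\bm y\neq \bm 0$ put $$\hat s_\nu(\bm y)=\frac{\pi^{\nu/2}}{\Gamma(\nu/2)}\Gamma\big(\tfrac{d-\nu}2\big)(\pi\bm y^2)^{(\nu-d)/2}\quad(\nu\notin d+2\mathbb N_0),$$ $$\hat s_{d+2k}(\bm y)=\frac{\pi^{k+d/2}}{\Gamma(k+d/2)}\frac{(-1)^{k+1}}{k!}(\pi\bm y^2)^k\log(\pi\bm y^2)\quad(k\in\mathbb N_0)$$ (the distributional Fourier transform of $|\cdot|^{-\nu}$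 away from $\bm 0$, with a choice of the free polynomial at the exponents $d+2k$). The regularised Epstein zeta function is $$Z^{\rm reg}_{\Lambda,\nu}(\bm x,\bm y)=e^{2\pi i\bm x\cdot\bm y}Z_{\Lambda,\nu}(\bm x,\bm y)-\frac1{V_\Lambda}\hat s_\nu(\bm y),\qquad \bm y\in\mathbb R^d\setminus\Lambda^*,$$ extended continuously to $\bm y=\bm 0$. The upper Crandall function is $G_\nu(\bm z)=\Gamma(\nu/2,\pi\bm z^2)/(\pi\bm z^2)^{\nu/2}$ for $\bm z\in\mathbb R^d\setminus\{\bm 0\}$, $G_\nu(\bm 0)=-2/\nu$, where $\Gamma(s,u)=\int_u^\infty t^{s-1}e^{-t}\,dt$ for $u>0$. The lower Crandall function is $g_\nu(\bm z)=\Gamma(\nu/2)\,\gamma^*(\nu/2,\pi\bm z^2)$ for $\nu\notin-2\mathbb N_0$, where $\gamma^*(s,w)=e^{-w}\sum_{n\ge0}w^n/\Gamma(s+n+1)$ is Tricomi's entire function, the entire extension of $\gamma(s,w)/(w^s\Gamma(s))$. For $\lambda>0$, the regularised upper Crandall function is $$G^{\rm reg}_{\nu,\lambda}(\bm y)=G_\nu(\lambda\bm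 y)-\lambda^{-\nu}\pi^{-(d-\nu)/2}\,\Gamma\big(\tfrac{d-\nu}2\big)\hat s_{d-\nu}(\bm y),\qquad \bm y\ne\bm 0,$$ extended continuously to $\bm y=\bm 0$; if $d-\nu\in-2\mathbb N_0$, the product $\Gamma(\frac{d-\nu}2)\hat s_{d-\nu}(\bm y)$ is read as its limiting value $\pi^{(d-\nu)/2}\Gamma(\nu/2)(\pi\bm y^2)^{-\nu/2}$. **Theorem.** Let $\bm x\in\mathbb R^d$, $\nu\in\mathbb C$, $\lambda>0$. 1. The continuous extensions to $\bm y=\bm 0$ above exist, and for $\bm y\notin\Lambda^*$ so does the meromorphic continuation in the definition of $Z_{\Lambda,\nu}(\bm x,\bm y)$. For every $\bm y\in(\mathbb R^d\setminus\Lambda^*)\cup\{\bm 0\}$, both series below converge absolutely and $$Z^{\rm reg}_{\Lambda,\nu}(\bm x,\bm y)=\frac{(\lambda^2/\pi)^{-\nu/2}}{\Gamma(\nu/2)}\Bigg[\sum_{\bm z\in\Lambda}G_\nu\Big(\frac{\bm z-\bm x}\lambda\Big)e^{-2\pi i\bm y\cdot(\bm z-\bm x)}+\frac{\lambda^d}{V_\Lambda}\Big[G^{\rm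 reg}_{d-\nu,\lambda}(\bm y)+\sum_{\bm k\in\Lambda^*,\ \bm k\ne\bm 0}G_{d-\nu}(\lambda(\bm k+\bm y))e^{-2\pi i\bm x\cdot\bm k}\Big]\Bigg],$$ where $1/\Gamma(\nu/2)=0$ for $\nu\in-2\mathbb N_0$. In the exceptional case $\nu=0$, $\bm x\in\Lambda$, the product $G_\nu(\bm 0)/\Gamma(\nu/2)=-1/\Gamma(\nu/2+1)$ coming from $\bm z=\bm x$ is read as its limit $-1$ as $\nu\to0$, so that the formula says $Z^{\rm reg}_{\Lambda,0}(\bm x,\bm y)=-1$. 2. If $\nu\notin-2\mathbb N_0$, then $G^{\rm reg}_{\nu,\lambda}(\bm y)=-g_\nu(\lambda\bm y)$ for all $\bm y\in\mathbb R^d$. 3. If $\nu=-2k$ with $k\in\mathbb N_0$, then for all $\bm y\in\mathbb R^d$ $$G^{\rm reg}_{\nu,\lambda}(\bm y)=\frac{(-1)^k}{k!}\big(H_k-\gamma-\log\lambda^2\big)(\pi\lambda^2\bm y^2)^k-\sum_{n\ge0,\ n\neq k}\frac{(-\pi\lambda^2\bm y^2)^n}{(n-k)\,n!},$$ with an absolutely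 convergent series, where $\gamma$ is the Euler–Mascheroni constant, $H_0=0$ and $H_k$ is the $k$-th harmonic number. -/

import Mathlib

open Filter Topology

noncomputable section

/-- The lattice `A ℤ^d` in Euclidean space. -/
def epsteinLattice {d : ℕ} (A : Matrix (Fin d) (Fin d) ℝ) : Set (EuclideanSpace ℝ (Fin d)) :=
  Set.range fun n : Fin d → ℤ => WithLp.toLp 2 (A.mulVec fun i => (n i : ℝ))

/-- The reciprocal lattice `A^{-T} ℤ^d`. -/
def reciprocalLattice {d : ℕ} (A : Matrix (Fin d) (Fin d) ℝ) :
    Set (EuclideanSpace ℝ (Fin d)) :=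
  epsteinLattice (A⁻¹).transpose

/-- The volume `|det A|` of the elementary cell of `A ℤ^d`. -/
def cellVolume {d : ℕ} (A : Matrix (Fin d) (Fin d) ℝ) : ℝ := |A.det|

/-- `f` is the meromorphic continuation to `ℂ` of the (unconditionally convergent) lattice sum
`ν ↦ ∑_{z ∈ Λ, z ≠ x} exp(-2πi y·z) / |x - z|^ν`, `Re ν > d`. The normal form condition fixes the
values of `f` at removable singularities by continuity (and sets it to `0` at poles), so that
there is at most one such `f`. -/
def IsEpsteinContinuation {d : ℕ} (A : Matrix (Fin d) (Fin d) ℝ)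
    (x y : EuclideanSpace ℝ (Fin d)) (f : ℂ → ℂ) : Prop :=
  MeromorphicNFOn f Set.univ ∧
    ∀ ν : ℂ, (d : ℝ) < ν.re →
      HasSum (fun z : ↥(epsteinLattice A \ {x}) =>
        Complex.exp (-(2 * Real.pi * Complex.I * (inner ℝ y (z : EuclideanSpace ℝ (Fin d)) : ℝ)))
          / ((‖x - (z : EuclideanSpace ℝ (Fin d))‖ : ℝ) : ℂ) ^ ν) (f ν)

open Classical in
/-- The Epstein zeta function `Z_{Λ,ν}(x, y)` of `Λ = A ℤ^d`. -/
def epsteinZeta {d : ℕ} (A : Matrix (Fin d) (Fin d) ℝ) (ν : ℂ)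
    (x y : EuclideanSpace ℝ (Fin d)) : ℂ :=
  if h : ∃ f : ℂ → ℂ, IsEpsteinContinuation A x y f then h.choose ν else 0

open Classical in
/-- The Fourier transform `ŝ_ν` of `|·|^{-ν}` on `ℝ^d` at `y ≠ 0`, with the logarithmic choice
at the exponents `ν = d + 2k`. Since Mathlib's `Complex.Gamma` is `0` at its poles, the quotient
by `Γ(ν/2)` is multiplication by the entire function `1/Γ(ν/2)`. -/
def powerFourier (d : ℕ) (ν : ℂ) (y : EuclideanSpace ℝ (Fin d)) : ℂ :=
  if h : ∃ k : ℕ, ν = d + 2 * k then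
    (Real.pi : ℂ) ^ ((h.choose : ℂ) + d / 2) / Complex.Gamma ((h.choose : ℂ) + d / 2)
      * ((-1) ^ (h.choose + 1) / (h.choose.factorial : ℂ))
      * (((Real.pi * ‖y‖ ^ 2) ^ h.choose * Real.log (Real.pi * ‖y‖ ^ 2) : ℝ) : ℂ)
  else
    (Real.pi : ℂ) ^ (ν / 2) / Complex.Gamma (ν / 2) * Complex.Gamma ((d - ν) / 2)
      * ((Real.pi * ‖y‖ ^ 2 : ℝ) : ℂ) ^ ((ν - d) / 2)

/-- The regularised Epstein zeta function away from `y = 0`. -/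
def epsteinZetaRegAux {d : ℕ} (A : Matrix (Fin d) (Fin d) ℝ) (ν : ℂ)
    (x y : EuclideanSpace ℝ (Fin d)) : ℂ :=
  Complex.exp (2 * Real.pi * Complex.I * (inner ℝ x y : ℝ)) * epsteinZeta A ν x y
    - (1 / (cellVolume A : ℂ)) * powerFourier d ν y

open Classical in
/-- The regularised Epstein zeta function, extended to `y = 0` as a limit. -/
def epsteinZetaReg {d : ℕ} (A : Matrix (Fin d) (Fin d) ℝ) (ν : ℂ)
    (x y : EuclideanSpace ℝ (Fin d)) : ℂ :=
  if y = 0 then limUnder (𝓝[≠] (0 : EuclideanSpace ℝ (Fin d))) (epsteinZetaRegAux A ν x)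
  else epsteinZetaRegAux A ν x y

/-- The upper incomplete gamma function `Γ(s, u)`, for `s ∈ ℂ` and real `u > 0`. -/
def upperIncompleteGamma (s : ℂ) (u : ℝ) : ℂ :=
  ∫ t in Set.Ioi u, Complex.exp (-(t : ℂ)) * (t : ℂ) ^ (s - 1)

/-- Tricomi's entire function `γ*(s, w) = e^{-w} ∑_n w^n / Γ(s + n + 1)`, where `1/Γ` vanishes at
the poles of `Γ`. -/
def tricomiGammaStar (s w : ℂ) : ℂ :=
  Complex.exp (-w) * ∑' n : ℕ, w ^ n / Complex.Gamma (s + n + 1)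

/-- The series defining `γ*` converges. -/
theorem summable_tricomiGammaStar (s : ℂ) (hs : 0 < s.re) (X : ℝ) :
    Summable fun n : ℕ => (X : ℂ) ^ n / Complex.Gamma (s + n + 1) := by
  by_cases hX : X = 0
  · refine summable_of_ne_finset_zero (s := {0}) fun n hn => ?_
    simp at hn
    simp [hX, hn]
  have hne : ∀ n : ℕ, Complex.Gamma (s + n + 1) ≠ 0 := fun n =>
    Complex.Gamma_ne_zero_of_re_pos (by simp; positivity)
  refine summable_of_ratio_test_tendsto_lt_one (l := 0) one_pos
    (Eventually.of_forall fun n => div_ne_zero (pow_ne_zero _ (by exact_mod_cast hX)) (hne n)) ?_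
  have h1 : ∀ n : ℕ, ‖(X : ℂ) ^ (n + 1) / Complex.Gamma (s + (n + 1 : ℕ) + 1)‖ /
      ‖(X : ℂ) ^ n / Complex.Gamma (s + n + 1)‖ = |X| / ‖s + n + 1‖ := by
    intro n
    have h0 : s + n + 1 ≠ 0 := fun h => by
      have := congrArg Complex.re h
      simp at this
      have : (0 : ℝ) ≤ n := by positivity
      linarith
    have h2 : Complex.Gamma (s + (n + 1 : ℕ) + 1) = (s + n + 1) * Complex.Gamma (s + n + 1) := by
      rw [← Complex.Gamma_add_one _ h0]; congr 1; push_cast; ring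
    rw [h2]
    have := hne n
    have hX' : |X| ≠ 0 := by simpa using hX
    simp only [norm_div, norm_mul, norm_pow, Complex.norm_real, Real.norm_eq_abs]
    have h3 : ‖s + n + 1‖ ≠ 0 := by simpa using h0
    have h4 : ‖Complex.Gamma (s + n + 1)‖ ≠ 0 := by simpa using this
    field_simp
    ring
  simp_rw [h1]
  refine squeeze_zero' (Eventually.of_forall fun n => by positivity)
    (g := fun n : ℕ => |X| / (n : ℝ)) ?_ (tendsto_const_div_atTop_nhds_zero_nat _)
  filter_upwards [eventually_gt_atTop 0] with n hn
  have : (n : ℝ) ≤ ‖s + n + 1‖ := by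
    refine le_trans ?_ (Complex.re_le_norm _)
    simp; linarith
  have hn' : (0 : ℝ) < n := by exact_mod_cast hn
  gcongr

/-- `γ*(s, X) = γ(s, X) / (X^s Γ(s))`, where `γ(s, X) = ∫_0^X e^{-t} t^{s-1} dt`. -/
theorem tricomiGammaStar_eq (s : ℂ) (hs : 0 < s.re) (X : ℝ) (hX : 0 < X) :
    tricomiGammaStar s X = Complex.partialGamma s X / ((X : ℂ) ^ s * Complex.Gamma s) := by
  have hXs : (X : ℂ) ^ s ≠ 0 := by simp [Complex.cpow_eq_zero_iff, hX.ne']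
  have hre : ∀ n : ℕ, 0 < (s + n).re := fun n => by simp; positivity
  have hG : ∀ n : ℕ, Complex.Gamma (s + n) ≠ 0 := fun n =>
    Complex.Gamma_ne_zero_of_re_pos (hre n)
  have hstep : ∀ N : ℕ, Complex.partialGamma s X / Complex.Gamma s =
      Complex.exp (-X) * X ^ s * ∑ n ∈ Finset.range N, (X : ℂ) ^ n / Complex.Gamma (s + n + 1)
        + Complex.partialGamma (s + N) X / Complex.Gamma (s + N) := by
    intro N
    induction N with
    | zero => simp
    | succ N ih =>
      rw [ih, Finset.sum_range_succ]
      have h0 : s + N ≠ 0 := fun h => by have := hre N; rw [h] at this; simp at this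
      have e : s + ((N + 1 : ℕ) : ℂ) = s + N + 1 := by push_cast; ring
      rw [e, Complex.partialGamma_add_one (hre N) hX.le, Complex.Gamma_add_one _ h0,
        Complex.cpow_add _ _ (by exact_mod_cast hX.ne'), Complex.cpow_natCast]
      have := hG N
      push_cast
      field_simp
      ring
  have hsum := summable_tricomiGammaStar s hs X
  have hrem : Tendsto (fun N : ℕ => Complex.partialGamma (s + N) X / Complex.Gamma (s + N))
      atTop (𝓝 0) := by
    have hz := (hsum.tendsto_atTop_zero.norm).const_mul (X ^ s.re * (1 + ‖s‖ / s.re))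
    rw [norm_zero, mul_zero] at hz
    refine squeeze_zero_norm (fun N => ?_) hz
    have h0 : s + N ≠ 0 := fun h => by have := hre N; rw [h] at this; simp at this
    have hP : ‖Complex.partialGamma (s + N) X‖ ≤ X ^ (s.re + N) / (s.re + N) := by
      unfold Complex.partialGamma
      have hr : (0 : ℝ) < s.re + N := by positivity
      have : ∫ t in (0 : ℝ)..X, t ^ (s.re + N - 1) = X ^ (s.re + N) / (s.re + N) := by
        rw [integral_rpow (Or.inl (by linarith))]
        simp [Real.zero_rpow hr.ne']
      rw [← this]
      refine intervalIntegral.norm_integral_le_of_norm_le hX.le ?_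
        (intervalIntegral.intervalIntegrable_rpow' (by linarith))
      refine Eventually.of_forall fun t ht => ?_
      rw [norm_mul, Complex.norm_cpow_eq_rpow_re_of_pos ht.1, Complex.norm_real, Real.norm_eq_abs, abs_of_pos (Real.exp_pos _)]
      simp only [Complex.sub_re, Complex.add_re, Complex.natCast_re, Complex.one_re]
      exact mul_le_of_le_one_left (Real.rpow_nonneg ht.1.le _)
        (Real.exp_le_one_iff.2 (by linarith [ht.1]))
    rw [Complex.Gamma_add_one _ h0]
    have h4 : 0 < ‖Complex.Gamma (s + N)‖ := by simpa using hG N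
    have h3 : 0 < ‖s + N‖ := by simpa using h0
    have hn : ‖s + N‖ ≤ (1 + ‖s‖ / s.re) * (s.re + N) := by
      have h5 : ‖s + N‖ ≤ ‖s‖ + N := by simpa using norm_add_le s (N : ℂ)
      have h6 : ‖s‖ / s.re * s.re = ‖s‖ := by field_simp
      have : 0 ≤ ‖s‖ / s.re * N := by positivity
      nlinarith
    have hr : (0 : ℝ) < s.re + N := by positivity
    simp only [norm_div, norm_mul, norm_pow, Complex.norm_real, Real.norm_eq_abs, abs_of_pos hX]
    rw [Real.rpow_add hX, Real.rpow_natCast] at hP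
    calc _ ≤ (X ^ s.re * X ^ N / (s.re + N)) / ‖Complex.Gamma (s + N)‖ := by gcongr
      _ = X ^ s.re * X ^ N / ‖Complex.Gamma (s + N)‖ / ‖s + N‖ * (‖s + N‖ / (s.re + N)) := by
        field_simp
      _ ≤ X ^ s.re * X ^ N / ‖Complex.Gamma (s + N)‖ / ‖s + N‖ * (1 + ‖s‖ / s.re) := by
        gcongr
        rwa [div_le_iff₀ hr]
      _ = _ := by field_simp
  have hl := ((hsum.hasSum.tendsto_sum_nat).const_mul (Complex.exp (-X) * X ^ s)).add hrem
  have := tendsto_nhds_unique (tendsto_const_nhds.congr hstep) hl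
  have hg := hG 0
  simp only [Nat.cast_zero, add_zero] at hg this
  rw [div_mul_eq_div_div_swap, this, tricomiGammaStar]
  field_simp

open Classical in
/-- The upper Crandall function `G_ν`. -/
def upperCrandall {d : ℕ} (ν : ℂ) (z : EuclideanSpace ℝ (Fin d)) : ℂ :=
  if z = 0 then -2 / ν
  else upperIncompleteGamma (ν / 2) (Real.pi * ‖z‖ ^ 2)
    / ((Real.pi * ‖z‖ ^ 2 : ℝ) : ℂ) ^ (ν / 2)

/-- The lower Crandall function `g_ν`, for `ν ∉ -2ℕ₀`. -/
def lowerCrandall {d : ℕ} (ν : ℂ) (z : EuclideanSpace ℝ (Fin d)) : ℂ :=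
  Complex.Gamma (ν / 2) * tricomiGammaStar (ν / 2) ((Real.pi * ‖z‖ ^ 2 : ℝ) : ℂ)

open Classical in
/-- The product `Γ(σ/2) ŝ_σ(y)`, `y ≠ 0`. At the poles `σ ∈ -2ℕ₀` of the first factor the second
one vanishes, and the product is given its limiting value, obtained by cancelling `Γ(σ/2)`. -/
def gammaMulPowerFourier (d : ℕ) (σ : ℂ) (y : EuclideanSpace ℝ (Fin d)) : ℂ :=
  if ∃ k : ℕ, σ = -(2 * k) then
    (Real.pi : ℂ) ^ (σ / 2) * Complex.Gamma ((d - σ) / 2)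
      * ((Real.pi * ‖y‖ ^ 2 : ℝ) : ℂ) ^ ((σ - d) / 2)
  else Complex.Gamma (σ / 2) * powerFourier d σ y

/-- The regularised upper Crandall function away from `y = 0`. -/
def upperCrandallRegAux {d : ℕ} (ν : ℂ) (lam : ℝ) (y : EuclideanSpace ℝ (Fin d)) : ℂ :=
  upperCrandall ν (lam • y)
    - (lam : ℂ) ^ (-ν) * (Real.pi : ℂ) ^ (-(d - ν) / 2) * gammaMulPowerFourier d (d - ν) y

open Classical in
/-- The regularised upper Crandall function `G^reg_{ν,λ}`, extended to `y = 0` as a limit. -/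
def upperCrandallReg {d : ℕ} (ν : ℂ) (lam : ℝ) (y : EuclideanSpace ℝ (Fin d)) : ℂ :=
  if y = 0 then limUnder (𝓝[≠] (0 : EuclideanSpace ℝ (Fin d))) (upperCrandallRegAux ν lam)
  else upperCrandallRegAux ν lam y

end

/-! The method is Riemann's. The function `Γ(ν/2) π^(-ν/2) |z|^(-ν)` is the Mellin integral of the
Gaussian `exp(-π |z|² t)`, so the Dirichlet series becomes the Mellin transform of a theta series,
and the integral is cut at `t = 1`. The part over `(1, ∞)` is a sum of Crandall functions `G_ν`,
converging like a Gaussian sum. On `(0, 1]` the theta transformation `hasSum_theta` (Poisson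
summation for a modulated Gaussian) followed by `t ↦ 1/t` produces the same kind of sum over the
reciprocal lattice, with exponent `d - ν`. This is `crandall_representation`, valid for `Re ν > d`.
A lattice point `z = x` is absent from the Dirichlet series, and `G_ν(0) = -2/ν` is precisely what
cancels its integral over `(0, 1]`.

Away from the origin the Crandall functions are entire in `ν`, with Gaussian bounds locally uniform
in `ν`, and `(-2/ν) / Γ(ν/2) = -1/Γ(ν/2 + 1)` has no pole. Hence the representation defines an
entire function `epsteinEntire`, and the identity theorem makes it the meromorphic continuation
(`epsteinZeta_eq`). A general cutoff `λ` is the case `λ = 1` for the lattice `λ⁻¹ Λ`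
(`epsteinEntire_smul`).

As `y → 0`, only the reciprocal summand `k = 0`, namely `G_{d-ν}(λ y)`, can fail to be continuous.
The term subtracted from it in `G^reg` corresponds, after the prefactors cancel, exactly to `ŝ_ν /
V`. With `X = π λ² y²`, the remainder is read off from the expansion of `∫_1^∞ t^(s-1) exp(-X t) dt`
in `X`: `expIntegral_eq_sub_tricomiGammaStar` away from the poles of `Γ(s)`, and the logarithmic
expansion `expIntegral_neg_natCast` at `s = -k`. Both remainders extend continuously to `X = 0`,
which gives the closed forms of `G^reg` and the extensions to `y = 0`. -/

noncomputable section

open MeasureTheory Set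

/-! ### Incomplete gamma integrals over `(1, ∞)` -/

/-- The integrand `t ^ (s - 1) * exp (-a t)` of the (incomplete) gamma integrals. -/
def gammaKernel (s : ℂ) (a t : ℝ) : ℂ := (t : ℂ) ^ (s - 1) * (Real.exp (-(a * t)) : ℂ)

/-- The integral `∫_1^∞ t ^ (s - 1) exp (-a t) dt`. -/
def expIntegral (s : ℂ) (a : ℝ) : ℂ := ∫ t in Ioi (1 : ℝ), gammaKernel s a t

theorem norm_gammaKernel (s : ℂ) (a : ℝ) {t : ℝ} (ht : 0 < t) :
    ‖gammaKernel s a t‖ = t ^ (s.re - 1) * Real.exp (-(a * t)) := by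
  rw [gammaKernel, norm_mul, Complex.norm_cpow_eq_rpow_re_of_pos ht, Complex.norm_real,
    Real.norm_eq_abs, abs_of_pos (Real.exp_pos _)]
  simp

theorem continuousOn_gammaKernel (s : ℂ) (a : ℝ) : ContinuousOn (gammaKernel s a) (Ioi 0) := by
  intro t ht
  have : ContinuousAt (fun t : ℝ => (t : ℂ) ^ (s - 1)) t :=
    Complex.continuousAt_ofReal_cpow_const _ _ (Or.inr (ne_of_gt ht))
  exact (this.mul (by fun_prop)).continuousWithinAt

theorem integrableOn_rpow_mul_exp_neg (R : ℝ) {b : ℝ} (hb : 0 < b) :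
    IntegrableOn (fun t : ℝ => t ^ (R - 1) * Real.exp (-(b * t))) (Ioi 1) := by
  -- Raising the exponent to `max R 1` makes the integral converge at `0` as well; on `t > 1` it
  -- only enlarges the integrand.
  have h := (integrableOn_rpow_mul_exp_neg_mul_rpow (p := 1) (s := max R 1 - 1) (b := b)
    (by linarith [le_max_right R 1]) one_pos hb).mono_set (Ioi_subset_Ioi zero_le_one)
  refine h.mono' ?_ ?_
  · refine ContinuousOn.aestronglyMeasurable (fun t ht => ?_) measurableSet_Ioi
    have h0 : t ≠ 0 := (zero_lt_one.trans ht).ne'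
    exact ((Real.continuousAt_rpow_const _ _ (Or.inl h0)).mul (by fun_prop)).continuousWithinAt
  · filter_upwards [ae_restrict_mem measurableSet_Ioi] with t ht
    have ht' : (1 : ℝ) ≤ t := le_of_lt ht
    rw [Real.norm_eq_abs, abs_of_nonneg (by positivity), Real.rpow_one, neg_mul]
    gcongr
    exact le_max_left _ _

/-- Since `a t = a t / 2 + a t / 2 ≥ a / 2 + δ t / 2`, one half of the exponent gives decay in `a`
and the other half leaves an integrable majorant independent of `a ≥ δ`. -/
theorem norm_gammaKernel_le {s : ℂ} {R δ a t : ℝ} (hs : s.re ≤ R) (ha : δ ≤ a) (hδ : 0 ≤ δ)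
    (ht : 1 ≤ t) :
    ‖gammaKernel s a t‖ ≤ Real.exp (-(a / 2)) * (t ^ (R - 1) * Real.exp (-(δ / 2 * t))) := by
  rw [norm_gammaKernel s a (by linarith), mul_left_comm, ← Real.exp_add]
  gcongr
  nlinarith

theorem integrableOn_gammaKernel (s : ℂ) {a : ℝ} (ha : 0 < a) :
    IntegrableOn (gammaKernel s a) (Ioi 1) := by
  refine ((integrableOn_rpow_mul_exp_neg s.re (half_pos ha)).const_mul
    (Real.exp (-(a / 2)))).mono'
    (((continuousOn_gammaKernel s a).mono
      (Ioi_subset_Ioi zero_le_one)).aestronglyMeasurable measurableSet_Ioi) ?_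
  filter_upwards [ae_restrict_mem measurableSet_Ioi] with t ht
  exact norm_gammaKernel_le le_rfl le_rfl ha.le (le_of_lt ht)

/-- The integrals `∫_1^∞ |t ^ (s - 1)| exp (-a t) dt` decay exponentially in `a`, locally uniformly
in `s`. -/
theorem exists_integral_norm_gammaKernel_le (R : ℝ) {δ : ℝ} (hδ : 0 < δ) :
    ∃ C : ℝ, 0 ≤ C ∧ ∀ s : ℂ, s.re ≤ R → ∀ a : ℝ, δ ≤ a →
      ∫ t in Ioi (1 : ℝ), ‖gammaKernel s a t‖ ≤ C * Real.exp (-(a / 2)) := by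
  refine ⟨∫ t in Ioi (1 : ℝ), t ^ (R - 1) * Real.exp (-(δ / 2 * t)), ?_, fun s hs a ha => ?_⟩
  · refine setIntegral_nonneg measurableSet_Ioi fun t ht => ?_
    have : (0 : ℝ) < t := zero_lt_one.trans ht
    positivity
  · rw [mul_comm, ← integral_const_mul]
    refine setIntegral_mono_on (integrableOn_gammaKernel s (hδ.trans_le ha)).norm
      ((integrableOn_rpow_mul_exp_neg R (half_pos hδ)).const_mul _) measurableSet_Ioi
      fun t ht => ?_
    exact norm_gammaKernel_le hs ha hδ.le (le_of_lt ht)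

theorem exists_norm_expIntegral_le (R : ℝ) {δ : ℝ} (hδ : 0 < δ) :
    ∃ C : ℝ, 0 ≤ C ∧ ∀ s : ℂ, s.re ≤ R → ∀ a : ℝ, δ ≤ a →
      ‖expIntegral s a‖ ≤ C * Real.exp (-(a / 2)) := by
  obtain ⟨C, hC, h⟩ := exists_integral_norm_gammaKernel_le R hδ
  exact ⟨C, hC, fun s hs a ha => (norm_integral_le_integral_norm _).trans (h s hs a ha)⟩

theorem continuousOn_expIntegral (s : ℂ) : ContinuousOn (expIntegral s) (Ioi 0) := by
  intro a ha
  have ha' : a / 2 < a := half_lt_self ha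
  suffices ContinuousOn (expIntegral s) (Ioi (a / 2)) from
    (this.continuousAt (Ioi_mem_nhds ha')).continuousWithinAt
  have ha2 : 0 < a / 2 := half_pos ha
  refine continuousOn_of_dominated
    (bound := fun t => t ^ (s.re - 1) * Real.exp (-(a / 2 / 2 * t)))
    (fun b _ => ((continuousOn_gammaKernel s b).mono
      (Ioi_subset_Ioi zero_le_one)).aestronglyMeasurable measurableSet_Ioi)
    (fun b hb => ?_) (integrableOn_rpow_mul_exp_neg _ (half_pos ha2)) ?_
  · filter_upwards [ae_restrict_mem measurableSet_Ioi] with t ht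
    refine (norm_gammaKernel_le le_rfl (le_of_lt hb) ha2.le (le_of_lt ht)).trans ?_
    have h0 : (0 : ℝ) < t := zero_lt_one.trans ht
    have hb' : (0 : ℝ) < b := ha2.trans hb
    exact mul_le_of_le_one_left (by positivity) (Real.exp_le_one_iff.2 (by linarith))
  · filter_upwards with t
    unfold gammaKernel
    fun_prop

/-- This is the Mellin transform of `exp(-a t)` cut off to `t > 1`: it vanishes near `0` and decays
exponentially, so the transform converges everywhere and is entire. -/
theorem differentiable_expIntegral {a : ℝ} (ha : 0 < a) :
    Differentiable ℂ fun s : ℂ => expIntegral s a := by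
  set f : ℝ → ℂ := (Ioi (1 : ℝ)).indicator fun t => (Real.exp (-(a * t)) : ℂ) with hf
  have h : (fun s : ℂ => expIntegral s a) = mellin f := by
    ext s
    rw [mellin, expIntegral, ← integral_indicator measurableSet_Ioi,
      ← integral_indicator measurableSet_Ioi]
    congr 1
    ext t
    by_cases ht : 1 < t
    · have : (0 : ℝ) < t := zero_lt_one.trans ht
      simp [hf, indicator, ht, this, gammaKernel]
    · simp [hf, indicator, ht]
  rw [h]
  intro s
  refine mellin_differentiableAt_of_isBigO_rpow_exp ha (b := s.re - 1) ?_ ?_ ?_ (by linarith)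
  · refine (Integrable.integrableOn ?_).locallyIntegrableOn
    rw [hf, integrable_indicator_iff measurableSet_Ioi]
    have := integrableOn_gammaKernel 1 ha
    exact this.congr_fun (fun t _ => by simp [gammaKernel]) measurableSet_Ioi
  · refine Asymptotics.IsBigO.of_bound 1 (Eventually.of_forall fun t => ?_)
    by_cases ht : 1 < t
    · simp [hf, ht, Complex.norm_exp]
    · simp [hf, ht, Real.exp_nonneg]
  · refine Asymptotics.IsBigO.of_bound 1 ?_
    filter_upwards [Ioo_mem_nhdsGT (zero_lt_one' ℝ)] with t ht
    have : ¬ 1 < t := not_lt.2 ht.2.le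
    simp only [hf, indicator, mem_Ioi, this, if_false, norm_zero]
    positivity

/-- The substitution `t ↦ u t`. It removes the quotient from the Crandall function, whose dependence
on `ν` then sits in the Mellin variable alone. -/
theorem upperIncompleteGamma_eq_expIntegral (s : ℂ) {u : ℝ} (hu : 0 < u) :
    upperIncompleteGamma s u = (u : ℂ) ^ s * expIntegral s u := by
  have hu' : (u : ℂ) ≠ 0 := by exact_mod_cast hu.ne'
  have h := integral_comp_mul_left_Ioi'
    (fun t : ℝ => Complex.exp (-(t : ℂ)) * (t : ℂ) ^ (s - 1)) 1 hu
  rw [mul_one] at h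
  rw [upperIncompleteGamma, ← h, expIntegral, Complex.real_smul, ← integral_const_mul,
    ← integral_const_mul]
  refine setIntegral_congr_fun measurableSet_Ioi fun t ht => ?_
  have ht' : (0 : ℝ) < t := zero_lt_one.trans ht
  simp only [gammaKernel]
  rw [Complex.ofReal_mul, Complex.mul_cpow_ofReal_nonneg hu.le ht'.le, Complex.cpow_sub _ _ hu']
  push_cast
  rw [Complex.cpow_one]
  field_simp

theorem upperCrandall_of_ne {d : ℕ} (ν : ℂ) {z : EuclideanSpace ℝ (Fin d)} (hz : z ≠ 0) :
    upperCrandall ν z = expIntegral (ν / 2) (Real.pi * ‖z‖ ^ 2) := by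
  have h0 : 0 < Real.pi * ‖z‖ ^ 2 := by positivity
  have h1 : ((Real.pi * ‖z‖ ^ 2 : ℝ) : ℂ) ^ (ν / 2) ≠ 0 := by
    rw [Complex.cpow_ne_zero_iff]
    exact Or.inl (by exact_mod_cast h0.ne')
  rw [upperCrandall, if_neg hz, upperIncompleteGamma_eq_expIntegral _ h0, mul_div_cancel_left₀ _ h1]

/-- Integration by parts: integrate the derivative of `-t^s exp(-a t)` over `(1, ∞)`. The recurrence
moves both expansions below to all the exponents needed. -/
theorem expIntegral_add_one (s : ℂ) {a : ℝ} (ha : 0 < a) :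
    a * expIntegral (s + 1) a = s * expIntegral s a + Real.exp (-a) := by
  have hd : ∀ t ∈ Ici (1 : ℝ), HasDerivAt (fun t : ℝ => -((t : ℂ) ^ s * (Real.exp (-(a * t)) : ℂ)))
      (a * gammaKernel (s + 1) a t - s * gammaKernel s a t) t := by
    intro t ht
    have ht0 : (0 : ℝ) < t := zero_lt_one.trans_le ht
    have h1 : HasDerivAt (fun t : ℝ => (t : ℂ) ^ s) (s * (t : ℂ) ^ (s - 1)) t := by
      by_cases hs : s = 0
      · simpa [hs] using hasDerivAt_const t (1 : ℂ)
      · simpa using HasDerivAt.comp_ofReal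
          (HasDerivAt.cpow_const (c := s) (hasDerivAt_id (t : ℂ)) (Or.inl (by simpa using ht0)))
    have h2 : HasDerivAt (fun t : ℝ => (Real.exp (-(a * t)) : ℂ))
        ((Real.exp (-(a * t)) * -(a * 1) : ℝ) : ℂ) t :=
      (((hasDerivAt_id t).const_mul a).neg.exp).ofReal_comp
    refine (h1.mul h2).neg.congr_deriv ?_
    simp only [gammaKernel, add_sub_cancel_right]
    push_cast
    ring
  have hlim : Tendsto (fun t : ℝ => -((t : ℂ) ^ s * (Real.exp (-(a * t)) : ℂ))) atTop (𝓝 0) := by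
    rw [tendsto_zero_iff_norm_tendsto_zero]
    refine (tendsto_rpow_mul_exp_neg_mul_atTop_nhds_zero s.re a ha).congr' ?_
    filter_upwards [eventually_gt_atTop 0] with t ht
    have := norm_gammaKernel (s + 1) a ht
    simp only [gammaKernel, add_sub_cancel_right, Complex.add_re, Complex.one_re] at this
    rw [norm_neg, this, neg_mul]
  have i1 := (integrableOn_gammaKernel (s + 1) ha).const_mul (a : ℂ)
  have i2 := (integrableOn_gammaKernel s ha).const_mul s
  have := integral_Ioi_of_hasDerivAt_of_tendsto' hd (i1.sub i2) hlim
  rw [integral_sub i1 i2, integral_const_mul, integral_const_mul] at this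
  simp only [Complex.ofReal_one, Complex.one_cpow, mul_one, one_mul, zero_sub, neg_neg] at this
  rw [expIntegral, expIntegral, ← this]
  ring

/-! ### Expansions of the incomplete gamma integral in `X` -/

/-- Dropping the first `N` terms replaces `s` by `s + N` up to the factor `X^N`, which reduces to
positive real part. -/
theorem summable_tricomiGammaStar_real (s : ℂ) (X : ℝ) :
    Summable fun n : ℕ => (X : ℂ) ^ n / Complex.Gamma (s + n + 1) := by
  obtain ⟨N, hN⟩ := exists_nat_gt (-s.re)
  rw [← summable_nat_add_iff N]
  have := (summable_tricomiGammaStar (s + N) (by simp; linarith) X).mul_left ((X : ℂ) ^ N)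
  refine this.congr fun n => ?_
  rw [pow_add, Nat.cast_add, add_right_comm s, add_assoc s, add_assoc s]
  ring_nf

theorem continuous_tricomiGammaStar (s : ℂ) : Continuous (tricomiGammaStar s) := by
  refine (Complex.continuous_exp.comp continuous_neg).mul ?_
  rw [continuous_iff_continuousAt]
  intro w
  have hc : ContinuousOn (fun w : ℂ => ∑' n : ℕ, w ^ n / Complex.Gamma (s + n + 1))
      (Metric.ball 0 (‖w‖ + 1)) := by
    refine continuousOn_tsum (fun n => by fun_prop)
      (summable_tricomiGammaStar_real s (‖w‖ + 1)).norm fun n z hz => ?_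
    rw [norm_div, norm_div, norm_pow, norm_pow, Complex.norm_real, Real.norm_eq_abs,
      abs_of_pos (by positivity : 0 < ‖w‖ + 1)]
    gcongr
    exact (mem_ball_zero_iff.1 hz).le
  exact hc.continuousAt (Metric.isOpen_ball.mem_nhds (by simp))

theorem tricomiGammaStar_add_one (s : ℂ) (X : ℝ) :
    tricomiGammaStar s X =
      Complex.exp (-X) / Complex.Gamma (s + 1) + X * tricomiGammaStar (s + 1) X := by
  have h : ∑' n : ℕ, (X : ℂ) ^ (n + 1) / Complex.Gamma (s + (n + 1 : ℕ) + 1) =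
      X * ∑' n : ℕ, (X : ℂ) ^ n / Complex.Gamma (s + 1 + n + 1) := by
    rw [← tsum_mul_left]
    refine tsum_congr fun n => ?_
    rw [pow_succ', Nat.cast_succ, show s + (n + 1) + 1 = s + 1 + n + 1 by ring, mul_div_assoc]
  rw [tricomiGammaStar, tricomiGammaStar, (summable_tricomiGammaStar_real s X).tsum_eq_zero_add, h]
  simp only [pow_zero, Nat.cast_zero, add_zero]
  ring

theorem expIntegral_eq_of_re_pos {s : ℂ} (hs : 0 < s.re) {X : ℝ} (hX : 0 < X) :
    expIntegral s X = (X : ℂ) ^ (-s) * (Complex.Gamma s - Complex.partialGamma s X) := by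
  have hX0 : (X : ℂ) ^ s ≠ 0 := by
    rw [Complex.cpow_ne_zero_iff]; exact Or.inl (by exact_mod_cast hX.ne')
  have h1 : Complex.Gamma s = Complex.partialGamma s X + upperIncompleteGamma s X := by
    have hi := Complex.GammaIntegral_convergent hs
    rw [Complex.Gamma_eq_integral hs, Complex.GammaIntegral, Complex.partialGamma,
      intervalIntegral.integral_of_le hX.le, upperIncompleteGamma, ← Ioc_union_Ioi_eq_Ioi hX.le,
      setIntegral_union (Ioc_disjoint_Ioi le_rfl) measurableSet_Ioi
        (hi.mono_set Ioc_subset_Ioi_self) (hi.mono_set (Ioi_subset_Ioi hX.le))]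
    simp only [Complex.ofReal_exp, Complex.ofReal_neg]
  rw [h1, upperIncompleteGamma_eq_expIntegral s hX, Complex.cpow_neg, add_sub_cancel_left]
  field_simp

/-- `Γ(s, X) - Γ(s) = -Γ(s) X ^ s γ*(s, X)`, divided by `X ^ s`. -/
theorem expIntegral_eq_sub_tricomiGammaStar {s : ℂ} (hs : ∀ m : ℕ, s ≠ -m) {X : ℝ} (hX : 0 < X) :
    expIntegral s X =
      Complex.Gamma s * (X : ℂ) ^ (-s) - Complex.Gamma s * tricomiGammaStar s X := by
  -- Both sides obey the same recurrence under `s ↦ s + 1`, and `N` steps carry `s` into the right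
  -- half plane, where `tricomiGammaStar_eq` applies. Excluding the poles keeps `s ≠ 0` at each
  -- step, so the recurrence can be solved backwards.
  have key : ∀ N : ℕ, ∀ s : ℂ, 0 < s.re + N → (∀ m : ℕ, s ≠ -m) → expIntegral s X =
      Complex.Gamma s * (X : ℂ) ^ (-s) - Complex.Gamma s * tricomiGammaStar s X := by
    have hX' : (X : ℂ) ≠ 0 := by exact_mod_cast hX.ne'
    intro N
    induction N with
    | zero =>
      intro s hs hm
      simp only [Nat.cast_zero, add_zero] at hs
      have hX0 : (X : ℂ) ^ s ≠ 0 := by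
        rw [Complex.cpow_ne_zero_iff]; exact Or.inl hX'
      have hG := Complex.Gamma_ne_zero hm
      rw [expIntegral_eq_of_re_pos hs hX, tricomiGammaStar_eq s hs X hX, Complex.cpow_neg]
      field_simp
    | succ N ih =>
      intro s hs hm
      have h0 : s ≠ 0 := by simpa using hm 0
      have hm' : ∀ m : ℕ, s + 1 ≠ -m := fun m h => hm (m + 1) (by
        rw [eq_sub_of_add_eq h]; push_cast; ring)
      have hG := Complex.Gamma_ne_zero hm'
      have hG' := Complex.Gamma_ne_zero hm
      have h1 := expIntegral_add_one s hX
      rw [ih (s + 1) (by push_cast at hs; simp; linarith) hm', Complex.Gamma_add_one s h0] at h1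
      have h2 := tricomiGammaStar_add_one s X
      rw [Complex.Gamma_add_one s h0] at h2
      have h3 : (X : ℂ) ^ (-(s + 1)) * X = (X : ℂ) ^ (-s) := by
        rw [neg_add', Complex.cpow_sub _ _ hX', Complex.cpow_one]
        field_simp
      rw [← mul_right_inj' h0, h2, ← h3]
      push_cast at h1
      field_simp
      linear_combination -h1
  obtain ⟨N, hN⟩ := exists_nat_gt (-s.re)
  exact key N s (by linarith) hs

/-- Expand `exp(-t)` and integrate term by term. The term `n = 0` isolates the pole `X^s / s` at `s
= 0`. -/
theorem hasSum_partialGamma {s : ℂ} (hs : 0 < s.re) {X : ℝ} (hX : 0 < X) :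
    HasSum (fun n : ℕ => (X : ℂ) ^ s * ((-X) ^ n / ((s + n) * n.factorial)))
      (Complex.partialGamma s X) := by
  have hF : ∀ n : ℕ, ∫ t in (0 : ℝ)..X, (-t : ℂ) ^ n / n.factorial * (t : ℂ) ^ (s - 1) =
      (X : ℂ) ^ s * ((-X) ^ n / ((s + n) * n.factorial)) := by
    intro n
    have hne : s + n ≠ 0 := fun h => by
      have := congrArg Complex.re h
      simp at this
      have : (0 : ℝ) ≤ n := n.cast_nonneg
      linarith
    have e : ∀ t ∈ uIoc 0 X, (-t : ℂ) ^ n / n.factorial * (t : ℂ) ^ (s - 1) =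
        ((-1) ^ n / n.factorial) * (t : ℂ) ^ (s + n - 1) := by
      intro t ht
      rw [uIoc_of_le hX.le] at ht
      have ht0 : (t : ℂ) ≠ 0 := by exact_mod_cast ht.1.ne'
      rw [add_sub_right_comm, Complex.cpow_add _ _ ht0, Complex.cpow_natCast, neg_pow]
      ring
    rw [intervalIntegral.integral_congr_ae (Eventually.of_forall e), intervalIntegral.integral_const_mul,
      integral_cpow (Or.inl (by simp; positivity)), sub_add_cancel, Complex.ofReal_zero,
      Complex.zero_cpow hne, Complex.cpow_add _ _ (by exact_mod_cast hX.ne'),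
      Complex.cpow_natCast, neg_pow (X : ℂ)]
    field_simp
    ring
  simp_rw [← hF]
  refine intervalIntegral.hasSum_integral_of_dominated_convergence
    (fun n t => X ^ n / n.factorial * t ^ (s.re - 1)) (fun n => ?_) (fun n => ?_) ?_ ?_ ?_
  · rw [uIoc_of_le hX.le]
    refine ContinuousOn.aestronglyMeasurable (fun t ht => ?_) measurableSet_Ioc
    exact ((by fun_prop : ContinuousAt (fun t : ℝ => (-t : ℂ) ^ n / n.factorial) t).mul
      (Complex.continuousAt_ofReal_cpow_const _ _ (Or.inr ht.1.ne'))).continuousWithinAt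
  · refine Eventually.of_forall fun t ht => ?_
    rw [uIoc_of_le hX.le] at ht
    rw [norm_mul, Complex.norm_cpow_eq_rpow_re_of_pos ht.1]
    simp only [norm_div, norm_pow, norm_neg, Complex.norm_real, Real.norm_eq_abs, abs_of_pos ht.1,
      Complex.norm_natCast, Complex.sub_re, Complex.one_re]
    have := ht.1
    have := ht.2
    gcongr
  · exact Eventually.of_forall fun t _ => (Real.summable_pow_div_factorial X).mul_right _
  · simp_rw [tsum_mul_right]
    exact (intervalIntegral.intervalIntegrable_rpow' (by linarith)).const_mul _
  · refine Eventually.of_forall fun t _ => ?_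
    have := (NormedSpace.expSeries_div_hasSum_exp (𝔸 := ℂ) (-t)).mul_right ((t : ℂ) ^ (s - 1))
    rwa [← Complex.exp_eq_exp_ℂ, ← Complex.ofReal_neg, ← Complex.ofReal_exp, Complex.ofReal_neg]
      at this

/-- The terms of the series `∑_{n ≠ k} (-X) ^ n / ((n - k) n!)`; the term at `n = k` is `0`. -/
def poleSeriesTerm (k : ℕ) (X : ℝ) (n : ℕ) : ℝ := (-X) ^ n / (((n : ℝ) - k) * n.factorial)

theorem poleSeriesTerm_self (k : ℕ) (X : ℝ) : poleSeriesTerm k X k = 0 := by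
  simp [poleSeriesTerm]

theorem abs_poleSeriesTerm_le (k : ℕ) {X r : ℝ} (hX : |X| ≤ r) (n : ℕ) :
    |poleSeriesTerm k X n| ≤ r ^ n / n.factorial := by
  have hr : 0 ≤ r := (abs_nonneg X).trans hX
  by_cases h : n = k
  · subst h
    rw [poleSeriesTerm_self, abs_zero]
    positivity
  · have h1 : (1 : ℝ) ≤ |(n : ℝ) - k| := by
      have : (1 : ℤ) ≤ |(n : ℤ) - k| := Int.one_le_abs (by omega)
      exact_mod_cast this
    rw [poleSeriesTerm, abs_div, abs_pow, abs_neg, abs_mul, Nat.abs_cast]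
    have : (0 : ℝ) < n.factorial := by positivity
    gcongr
    exact le_mul_of_one_le_left this.le h1

theorem summable_poleSeriesTerm (k : ℕ) (X : ℝ) : Summable (poleSeriesTerm k X) :=
  (Real.summable_pow_div_factorial |X|).of_norm_bounded (abs_poleSeriesTerm_le k le_rfl)

theorem continuous_tsum_poleSeriesTerm (k : ℕ) :
    Continuous fun X : ℝ => ∑' n, poleSeriesTerm k X n := by
  rw [continuous_iff_continuousAt]
  intro X
  have hc : ContinuousOn (fun X : ℝ => ∑' n, poleSeriesTerm k X n) (Metric.ball 0 (|X| + 1)) := by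
    refine continuousOn_tsum (fun n => by unfold poleSeriesTerm; fun_prop)
      (Real.summable_pow_div_factorial (|X| + 1)) fun n z hz => abs_poleSeriesTerm_le k ?_ n
    simpa using (mem_ball_zero_iff.1 hz).le
  exact hc.continuousAt (Metric.isOpen_ball.mem_nhds (by simp))

/-- For `n ≠ k + 1`, `(k + 1)/(n - (k + 1)) = n/(n - (k + 1)) - 1`: the first part is the series for
`k` shifted by one index, the second the exponential series. Its term at `n = k + 1` must be given
back, because the pole series has `0` there. -/
theorem tsum_poleSeriesTerm_succ (k : ℕ) (X : ℝ) :
    ((k : ℝ) + 1) * ∑' n, poleSeriesTerm (k + 1) X n =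
      (-X) ^ (k + 1) / (k + 1).factorial - Real.exp (-X) - X * ∑' n, poleSeriesTerm k X n := by
  have h1 : HasSum (fun n : ℕ => (-X) ^ n / n.factorial) (Real.exp (-X)) := by
    have := NormedSpace.expSeries_div_hasSum_exp (𝔸 := ℝ) (-X)
    rwa [← Real.exp_eq_exp_ℝ] at this
  have h2 : HasSum (fun n : ℕ => (-X) ^ n * n / (((n : ℝ) - (k + 1)) * n.factorial))
      (-X * ∑' n, poleSeriesTerm k X n) := by
    rw [← hasSum_nat_add_iff' 1]
    simp only [Finset.range_one, Finset.sum_singleton, Nat.cast_zero, mul_zero, zero_div, sub_zero]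
    refine ((summable_poleSeriesTerm k X).hasSum.mul_left (-X)).congr_fun fun n => ?_
    rw [poleSeriesTerm, Nat.factorial_succ, pow_succ]
    have : (n : ℝ) + 1 ≠ 0 := by positivity
    push_cast
    rw [add_sub_add_right_eq_sub]
    by_cases h : (n : ℝ) - k = 0
    · simp [h]
    · field_simp
  have h3 := (summable_poleSeriesTerm (k + 1) X).hasSum.mul_left ((k : ℝ) + 1)
  have h4 := (hasSum_ite_eq (k + 1) ((-X) ^ (k + 1) / ((k + 1).factorial : ℝ))).sub h1
  have h5 := h4.add h2
  rw [h3.unique (h5.congr_fun fun n => ?_)]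
  · ring
  · by_cases hn : n = k + 1
    · subst hn
      simp [poleSeriesTerm_self]
    · have : (n : ℝ) - (k + 1) ≠ 0 := fun h => hn (by
        have : (n : ℝ) = (k + 1 : ℕ) := by push_cast; linarith
        exact_mod_cast this)
      rw [poleSeriesTerm, if_neg hn]
      push_cast
      field_simp
      ring

/-- The exponential integral `∫_1^∞ exp (-X t) dt / t = -γ - log X - ∑_{n ≥ 1} (-X) ^ n / (n n!)`. -/
theorem expIntegral_zero_eq {X : ℝ} (hX : 0 < X) :
    expIntegral 0 X = ((-Real.eulerMascheroniConstant - Real.log X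
      - ∑' n, poleSeriesTerm 0 X n : ℝ) : ℂ) := by
  have hX' : (X : ℂ) ≠ 0 := by exact_mod_cast hX.ne'
  have hcoe : Tendsto (fun e : ℝ => (e : ℂ)) (𝓝[>] 0) (𝓝[≠] 0) := by
    refine tendsto_nhdsWithin_iff.2 ⟨?_, ?_⟩
    · exact (Complex.continuous_ofReal.tendsto' 0 0 rfl).mono_left nhdsWithin_le_nhds
    · filter_upwards [self_mem_nhdsWithin] with e he
      simpa using (ne_of_gt he : e ≠ 0)
  have hlhs : Tendsto (fun e : ℝ => expIntegral (e : ℂ) X) (𝓝[>] 0) (𝓝 (expIntegral 0 X)) :=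
    ((differentiable_expIntegral hX).continuous.tendsto 0).comp
      (hcoe.mono_right nhdsWithin_le_nhds)
  -- Near `s = 0` the poles of `Γ(s)` and of the leading term `X^s / s` cancel: `X^(-s) (Γ(s) - X^s
  -- / s) = (X^(-s) Γ(1 + s) - 1) / s` is a difference quotient at `0`. Its limit supplies `-log X -
  -- γ`.
  have hder : HasDerivAt (fun s : ℂ => (X : ℂ) ^ (-s) * Complex.Gamma (1 + s))
      (-(Complex.log X) - Real.eulerMascheroniConstant) 0 := by
    have h1 : HasDerivAt (fun s : ℂ => (X : ℂ) ^ (-s)) (-(Complex.log X)) 0 := by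
      simpa using (hasDerivAt_id (0 : ℂ)).neg.const_cpow (c := (X : ℂ)) (Or.inl hX')
    have h2 : HasDerivAt (fun s : ℂ => Complex.Gamma (1 + s)) (-Real.eulerMascheroniConstant) 0 :=
      HasDerivAt.comp_const_add 1 0 (by simpa using Complex.hasDerivAt_Gamma_one)
    refine (h1.mul h2).congr_deriv ?_
    simp
    ring
  have hslope := (hasDerivAt_iff_tendsto_slope.1 hder).comp hcoe
  have hsum : Tendsto (fun e : ℝ => ∑' n : ℕ, (-X : ℂ) ^ (n + 1) /
      ((e + (n + 1 : ℕ)) * (n + 1).factorial)) (𝓝[>] 0)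
      (𝓝 (∑' n : ℕ, (-X : ℂ) ^ (n + 1) / ((0 + (n + 1 : ℕ)) * (n + 1).factorial))) := by
    refine tendsto_tsum_of_dominated_convergence
      (bound := fun n : ℕ => X ^ (n + 1) / (n + 1).factorial)
      ((summable_nat_add_iff 1).2 (Real.summable_pow_div_factorial X)) (fun n => ?_) ?_
    · refine tendsto_const_nhds.div (Tendsto.mul ?_ tendsto_const_nhds) ?_
      · exact (hcoe.mono_right nhdsWithin_le_nhds).add tendsto_const_nhds
      · rw [zero_add]
        exact_mod_cast mul_ne_zero (Nat.succ_ne_zero n) (Nat.factorial_ne_zero _)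
    · filter_upwards [self_mem_nhdsWithin] with e he n
      have he' : (0 : ℝ) < e := he
      rw [norm_div, norm_pow, norm_neg, Complex.norm_real, Real.norm_eq_abs, abs_of_pos hX,
        norm_mul, Complex.norm_natCast]
      have h1 : (1 : ℝ) ≤ ‖(e : ℂ) + (n + 1 : ℕ)‖ := by
        rw [← Complex.ofReal_natCast, ← Complex.ofReal_add, Complex.norm_real, Real.norm_eq_abs]
        push_cast
        exact le_trans (by linarith [n.cast_nonneg (α := ℝ)]) (le_abs_self _)
      have : (0 : ℝ) < (n + 1).factorial := by positivity
      gcongr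
      exact le_mul_of_one_le_left this.le h1
  have heq : ∀ᶠ e : ℝ in 𝓝[>] 0, expIntegral (e : ℂ) X =
      slope (fun s : ℂ => (X : ℂ) ^ (-s) * Complex.Gamma (1 + s)) 0 e -
      ∑' n : ℕ, (-X : ℂ) ^ (n + 1) / ((e + (n + 1 : ℕ)) * (n + 1).factorial) := by
    filter_upwards [self_mem_nhdsWithin] with e he
    have he0 : (e : ℂ) ≠ 0 := by exact_mod_cast (ne_of_gt he : e ≠ 0)
    have hre : 0 < (e : ℂ).re := by simpa using he
    have hXe : (X : ℂ) ^ (e : ℂ) ≠ 0 := by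
      rw [Complex.cpow_ne_zero_iff]; exact Or.inl hX'
    have hp := hasSum_partialGamma hre hX
    rw [expIntegral_eq_of_re_pos hre hX, ← hp.tsum_eq, hp.summable.tsum_eq_zero_add, slope_def_field,
      add_comm 1 (e : ℂ), Complex.Gamma_add_one _ he0, tsum_mul_left, Complex.cpow_neg]
    simp only [neg_zero, Complex.cpow_zero, add_zero, Complex.Gamma_one, pow_zero, Nat.cast_zero,
      Nat.factorial_zero, Nat.cast_one, mul_one, sub_zero]
    field_simp
    ring
  have := tendsto_nhds_unique (hlhs.congr' heq) (hslope.sub hsum)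
  rw [this, (summable_poleSeriesTerm 0 X).tsum_eq_zero_add, poleSeriesTerm_self, zero_add,
    Complex.ofReal_sub, Complex.ofReal_sub, Complex.ofReal_tsum, Complex.ofReal_log hX.le]
  simp only [poleSeriesTerm]
  push_cast
  simp only [zero_add, sub_zero]
  ring

/-- The value of `Γ(-k, X) X ^ k` for natural numbers `k`. -/
theorem expIntegral_neg_natCast (k : ℕ) {X : ℝ} (hX : 0 < X) :
    expIntegral (-k) X = (((-1) ^ k / (k.factorial : ℝ)
      * ((harmonic k : ℝ) - Real.eulerMascheroniConstant - Real.log X) * X ^ k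
      - ∑' n, poleSeriesTerm k X n : ℝ) : ℂ) := by
  induction k with
  | zero =>
    rw [Nat.cast_zero, neg_zero, expIntegral_zero_eq hX]
    congr 1
    simp
  | succ k ih =>
    have h1 := expIntegral_add_one (-((k + 1 : ℕ) : ℂ)) hX
    rw [show -((k + 1 : ℕ) : ℂ) + 1 = -k by push_cast; ring, ih] at h1
    -- The exponentials and the multiples of the series for `k` cancel; the remaining `(-X)^(k+1) /
    -- (k+1)!` is what raises `H_k` to `H_{k+1}`.
    have h2 := tsum_poleSeriesTerm_succ k X
    have h3 : ((k : ℂ) + 1) ≠ 0 := by exact_mod_cast Nat.succ_ne_zero k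
    have h3' : ((k : ℝ) + 1) ≠ 0 := by exact_mod_cast Nat.succ_ne_zero k
    have h4 : ((k : ℂ) + 1) * expIntegral (-((k + 1 : ℕ) : ℂ)) X = ((Real.exp (-X) - X *
        ((-1) ^ k / (k.factorial : ℝ)
        * ((harmonic k : ℝ) - Real.eulerMascheroniConstant - Real.log X) * X ^ k
        - ∑' n, poleSeriesTerm k X n) : ℝ) : ℂ) := by
      push_cast at h1 ⊢
      linear_combination h1
    rw [← mul_right_inj' h3, h4, ← Complex.ofReal_natCast k, ← Complex.ofReal_one,
      ← Complex.ofReal_add, ← Complex.ofReal_mul]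
    congr 1
    rw [mul_sub ((k : ℝ) + 1), h2, harmonic_succ, Nat.factorial_succ]
    push_cast
    have : (k.factorial : ℝ) ≠ 0 := by positivity
    field_simp
    rw [neg_pow X]
    ring

/-! ### Lattices: duality, discreteness and convergence of sums -/

/-- The linear map `v ↦ A v` into Euclidean space. -/
def matrixMap {d : ℕ} (A : Matrix (Fin d) (Fin d) ℝ) :
    (Fin d → ℝ) →ₗ[ℝ] EuclideanSpace ℝ (Fin d) :=
  (WithLp.linearEquiv 2 ℝ (Fin d → ℝ)).symm.toLinearMap ∘ₗ A.mulVecLin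

theorem matrixMap_apply {d : ℕ} (A : Matrix (Fin d) (Fin d) ℝ) (v : Fin d → ℝ) :
    matrixMap A v = WithLp.toLp 2 (A.mulVec v) := rfl

theorem continuous_matrixMap {d : ℕ} (A : Matrix (Fin d) (Fin d) ℝ) : Continuous (matrixMap A) :=
  LinearMap.continuous_of_finiteDimensional _

/-- The point `A n` of the lattice `A ℤ^d`. -/
def latticePoint {d : ℕ} (A : Matrix (Fin d) (Fin d) ℝ) (n : Fin d → ℤ) :
    EuclideanSpace ℝ (Fin d) := matrixMap A fun i => (n i : ℝ)

theorem latticePoint_zero {d : ℕ} (A : Matrix (Fin d) (Fin d) ℝ) : latticePoint A 0 = 0 := by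
  simp only [latticePoint, Pi.zero_apply, Int.cast_zero]
  exact (matrixMap A).map_zero

theorem latticePoint_neg {d : ℕ} (A : Matrix (Fin d) (Fin d) ℝ) (n : Fin d → ℤ) :
    latticePoint A (-n) = -latticePoint A n := by
  rw [latticePoint, latticePoint, ← map_neg]
  congr 1
  ext i
  simp

theorem latticePoint_smul {d : ℕ} (c : ℝ) (A : Matrix (Fin d) (Fin d) ℝ) (n : Fin d → ℤ) :
    latticePoint (c • A) n = c • latticePoint A n := by
  simp only [latticePoint, matrixMap_apply, Matrix.smul_mulVec, WithLp.toLp_smul]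

theorem epsteinLattice_eq_range {d : ℕ} (A : Matrix (Fin d) (Fin d) ℝ) :
    epsteinLattice A = range (latticePoint A) := rfl

theorem inner_matrixMap {d : ℕ} {A : Matrix (Fin d) (Fin d) ℝ} (hA : A.det ≠ 0)
    (v w : Fin d → ℝ) : inner ℝ (matrixMap A⁻¹.transpose v) (matrixMap A w) = ∑ i, v i * w i := by
  have : inner ℝ (matrixMap A⁻¹.transpose v) (matrixMap A w) = w ⬝ᵥ v := by
    rw [matrixMap_apply, matrixMap_apply, EuclideanSpace.inner_toLp_toLp]
    rw [star_trivial, Matrix.mulVec_transpose, dotProduct_comm, ← Matrix.dotProduct_mulVec,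
      Matrix.mulVec_mulVec, Matrix.nonsing_inv_mul A (isUnit_iff_ne_zero.2 hA), Matrix.one_mulVec,
      dotProduct_comm]
  rw [this, dotProduct]
  exact Finset.sum_congr rfl fun i _ => mul_comm _ _

theorem matrixMap_injective {d : ℕ} {A : Matrix (Fin d) (Fin d) ℝ} (hA : A.det ≠ 0) :
    Function.Injective (matrixMap A) := fun _ _ h =>
  Matrix.mulVec_injective_of_isUnit ((Matrix.isUnit_iff_isUnit_det A).2 (isUnit_iff_ne_zero.2 hA))
    ((WithLp.linearEquiv 2 ℝ (Fin d → ℝ)).symm.injective h)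

theorem latticePoint_injective {d : ℕ} {A : Matrix (Fin d) (Fin d) ℝ} (hA : A.det ≠ 0) :
    Function.Injective (latticePoint A) := fun m n h => by
  have := matrixMap_injective hA h
  ext i
  exact_mod_cast congrFun this i

theorem det_inv_transpose_ne_zero {d : ℕ} {A : Matrix (Fin d) (Fin d) ℝ} (hA : A.det ≠ 0) :
    (A⁻¹.transpose).det ≠ 0 := by
  rw [Matrix.det_transpose, Matrix.det_nonsing_inv, Ring.inverse_eq_inv']
  exact inv_ne_zero hA

/-- The linear equivalence `v ↦ A v` for a regular matrix `A`. -/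
def matrixEquiv {d : ℕ} {A : Matrix (Fin d) (Fin d) ℝ} (hA : A.det ≠ 0) :
    (Fin d → ℝ) ≃ₗ[ℝ] EuclideanSpace ℝ (Fin d) :=
  LinearEquiv.ofInjectiveOfFinrankEq (matrixMap A) (matrixMap_injective hA) (by simp)

theorem matrixEquiv_apply {d : ℕ} {A : Matrix (Fin d) (Fin d) ℝ} (hA : A.det ≠ 0)
    (v : Fin d → ℝ) : matrixEquiv hA v = matrixMap A v := rfl

/-- Linear independence over `ℝ` makes integer coordinates injective into the `ℤ`-span of the basis,
a lattice of rank `d`, so summability over that lattice can be pulled back. -/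
theorem summable_norm_sum_smul_sub_rpow {d : ℕ} {E : Type*} [NormedAddCommGroup E]
    [NormedSpace ℝ E] (b : Module.Basis (Fin d) ℝ E) (x : E) {r : ℝ} (hr : r < -d) :
    Summable fun n : Fin d → ℤ => ‖∑ i, n i • b i - x‖ ^ r := by
  have : FiniteDimensional ℝ E := b.finiteDimensional_of_finite
  have hrank : Module.finrank ℤ (Submodule.span ℤ (range b)) = d := by
    rw [ZLattice.rank ℝ (Submodule.span ℤ (range b)), Module.finrank_eq_card_basis b,
      Fintype.card_fin]
  have h := ZLattice.summable_norm_sub_rpow (Submodule.span ℤ (range b)) r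
    (by rw [hrank]; exact hr) x
  refine h.comp_injective (i := fun n : Fin d → ℤ => (⟨∑ i, n i • b i, Submodule.sum_mem _ fun i _ =>
    Submodule.smul_mem _ _ (Submodule.subset_span ⟨i, rfl⟩)⟩ : Submodule.span ℤ (range b)))
    fun m n hmn => ?_
  have h1 : ∑ i, m i • b i = ∑ i, n i • b i := congrArg Subtype.val hmn
  have h2 : ∑ i, (m i : ℝ) • b i = ∑ i, (n i : ℝ) • b i := by
    simpa only [Int.cast_smul_eq_zsmul] using h1
  ext i
  have := congrArg (fun v => b.repr v i) h2
  simp only [Module.Basis.repr_sum_self] at this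
  exact_mod_cast this

theorem latticePoint_eq_sum {d : ℕ} {A : Matrix (Fin d) (Fin d) ℝ} (hA : A.det ≠ 0)
    (n : Fin d → ℤ) :
    latticePoint A n = ∑ i, n i • ((Pi.basisFun ℝ (Fin d)).map (matrixEquiv hA)) i := by
  have h : (fun i => (n i : ℝ)) = ∑ i, (n i : ℝ) • Pi.basisFun ℝ (Fin d) i := by
    ext j
    simp [Pi.single_apply]
  rw [latticePoint, h, map_sum]
  refine Finset.sum_congr rfl fun i _ => ?_
  rw [map_smul, Module.Basis.map_apply, matrixEquiv_apply, Int.cast_smul_eq_zsmul]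

theorem summable_norm_latticePoint_sub_rpow {d : ℕ} {A : Matrix (Fin d) (Fin d) ℝ}
    (hA : A.det ≠ 0) (x : EuclideanSpace ℝ (Fin d)) {r : ℝ} (hr : r < -d) :
    Summable fun n : Fin d → ℤ => ‖latticePoint A n - x‖ ^ r := by
  simp_rw [latticePoint_eq_sum hA]
  exact summable_norm_sum_smul_sub_rpow _ x hr

theorem finite_latticePoint_eq {d : ℕ} {A : Matrix (Fin d) (Fin d) ℝ} (hA : A.det ≠ 0)
    (x : EuclideanSpace ℝ (Fin d)) : {n : Fin d → ℤ | latticePoint A n = x}.Finite :=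
  Set.Subsingleton.finite fun _ hm _ hn => latticePoint_injective hA (hm.trans hn.symm)

/-- Gaussian sums over lattices converge. -/
theorem summable_exp_neg_norm_sq {d : ℕ} {A : Matrix (Fin d) (Fin d) ℝ} (hA : A.det ≠ 0)
    (x : EuclideanSpace ℝ (Fin d)) {c : ℝ} (hc : 0 < c) :
    Summable fun n : Fin d → ℤ => Real.exp (-(c * ‖latticePoint A n - x‖ ^ 2)) := by
  -- The power `-2(d + 1)` is summable, and it dominates the Gaussian through `u^(d+1) / (d+1)! ≤
  -- exp u` with `u = c |z|²`, except possibly at the single point `z = 0`.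
  have h := (summable_norm_latticePoint_sub_rpow hA x (r := -(2 * (d + 1) : ℕ))
    (by push_cast; linarith [d.cast_nonneg (α := ℝ)])).mul_left ((d + 1).factorial / c ^ (d + 1))
  refine h.of_norm_bounded_eventually ?_
  refine (finite_latticePoint_eq hA x).subset fun n hn => ?_
  contrapose! hn
  simp only [mem_compl_iff, mem_ofPred_eq, not_le, not_lt] at hn ⊢
  have ht : 0 < ‖latticePoint A n - x‖ := norm_pos_iff.2 (sub_ne_zero.2 hn)
  generalize ‖latticePoint A n - x‖ = t at ht
  have h1 := Real.pow_div_factorial_le_exp (c * t ^ 2) (by positivity) (d + 1)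
  rw [Real.norm_eq_abs, abs_of_pos (Real.exp_pos _), Real.exp_neg, Real.rpow_neg ht.le,
    Real.rpow_natCast, pow_mul]
  rw [mul_pow] at h1
  calc (Real.exp (c * t ^ 2))⁻¹ ≤ (c ^ (d + 1) * (t ^ 2) ^ (d + 1) / (d + 1).factorial)⁻¹ := by
        gcongr
    _ = _ := by field_simp

/-- Discreteness from convergence: terms of a summable Gaussian family tend to `0`, so only finitely
many lattice points lie within distance `1` of `x`, and the least positive distance among them is
attained. -/
theorem exists_le_norm_latticePoint_sub {d : ℕ} {A : Matrix (Fin d) (Fin d) ℝ} (hA : A.det ≠ 0)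
    (x : EuclideanSpace ℝ (Fin d)) :
    ∃ δ > 0, ∀ n : Fin d → ℤ, latticePoint A n ≠ x → δ ≤ ‖latticePoint A n - x‖ := by
  have h := (summable_exp_neg_norm_sq hA x one_pos).tendsto_cofinite_zero.eventually
    (gt_mem_nhds (Real.exp_pos (-1)))
  have hfin : {n : Fin d → ℤ | ‖latticePoint A n - x‖ ≤ 1}.Finite := by
    refine Set.Finite.subset h fun n hn => ?_
    simp only [mem_ofPred_eq, not_lt, mem_compl_iff] at hn ⊢
    refine Real.exp_le_exp.2 ?_
    have : ‖latticePoint A n - x‖ ^ 2 ≤ 1 := pow_le_one₀ (norm_nonneg _) hn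
    linarith
  have hfin' : {n : Fin d → ℤ | ‖latticePoint A n - x‖ ≤ 1 ∧ latticePoint A n ≠ x}.Finite :=
    hfin.subset fun n hn => hn.1
  obtain ⟨δ, hδ, h⟩ : ∃ δ > 0, ∀ n ∈ hfin'.toFinset, δ ≤ ‖latticePoint A n - x‖ := by
    generalize hS : hfin'.toFinset = S
    have hpos : ∀ n ∈ S, 0 < ‖latticePoint A n - x‖ := fun n hn => by
      rw [← hS, Set.Finite.mem_toFinset] at hn
      exact norm_pos_iff.2 (sub_ne_zero.2 hn.2)
    by_cases hne : S.Nonempty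
    · obtain ⟨m, hm, hmin⟩ := S.exists_min_image (fun n => ‖latticePoint A n - x‖) hne
      exact ⟨_, hpos m hm, hmin⟩
    · exact ⟨1, one_pos, fun n hn => absurd ⟨n, hn⟩ hne⟩
  refine ⟨min δ 1, lt_min hδ one_pos, fun n hn => ?_⟩
  by_cases h1 : ‖latticePoint A n - x‖ ≤ 1
  · exact (min_le_left _ _).trans (h n (hfin'.mem_toFinset.2 ⟨h1, hn⟩))
  · exact (min_le_right _ _).trans (le_of_not_ge h1)

/-! ### Poisson summation on `ℤ^d` -/

/-- The unit cell `∏ i, (m i, m i + 1]`. -/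
def unitCell {ι : Type*} (m : ι → ℤ) : Set (ι → ℝ) := {v | ∀ i, v i ∈ Ioc (m i : ℝ) (m i + 1)}

theorem measurableSet_unitCell {ι : Type*} [Finite ι] (m : ι → ℤ) :
    MeasurableSet (unitCell m) :=
  MeasurableSet.univ_pi' fun _ => measurableSet_Ioc

theorem mem_unitCell_iff {ι : Type*} {m : ι → ℤ} {v : ι → ℝ} :
    v ∈ unitCell m ↔ m = fun i => ⌈v i⌉ - 1 := by
  rw [funext_iff]
  refine forall_congr' fun i => ?_
  rw [eq_sub_iff_add_eq, eq_comm, Int.ceil_eq_iff]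
  push_cast
  rw [add_sub_cancel_right]
  rfl

/-- The half-open cells partition the space, and each one is an integer translate of the cell at the
origin: this is the unfolding step of Poisson summation. -/
theorem hasSum_integral_unitCell {ι E : Type*} [Fintype ι] [NormedAddCommGroup E] [NormedSpace ℝ E]
    {g : (ι → ℝ) → E} (hg : Integrable g) :
    HasSum (fun m : ι → ℤ => ∫ v in unitCell (0 : ι → ℤ), g (v + fun i => (m i : ℝ)))
      (∫ v, g v) := by
  have hU : ⋃ m : ι → ℤ, unitCell m = univ :=
    eq_univ_of_forall fun v => mem_iUnion.2 ⟨_, mem_unitCell_iff.2 rfl⟩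
  have hd : Pairwise (Function.onFun Disjoint (unitCell (ι := ι))) := fun m n hmn =>
    Set.disjoint_left.2 fun v hm hn =>
      hmn ((mem_unitCell_iff.1 hm).trans (mem_unitCell_iff.1 hn).symm)
  have h := hasSum_integral_iUnion measurableSet_unitCell hd hg.integrableOn
  rw [hU, setIntegral_univ] at h
  refine h.congr_fun fun m => ?_
  have hp := measurePreserving_add_right (volume : Measure (ι → ℝ)) fun i => (m i : ℝ)
  have := hp.setIntegral_preimage_emb (measurableEmbedding_addRight _) g (unitCell m)
  rw [← this]
  congr 2
  ext v
  simp only [unitCell, mem_preimage, mem_ofPred_eq, Pi.add_apply, mem_Ioc, Pi.zero_apply,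
    Int.cast_zero, zero_add]
  refine forall_congr' fun i => ?_
  rw [lt_add_iff_pos_left, add_comm (m i : ℝ), add_le_add_iff_right]

/-- The character `v ↦ exp (2πi n·v)` of `ℝ^d`. -/
def piChar {ι : Type*} [Fintype ι] (n : ι → ℤ) (v : ι → ℝ) : ℂ :=
  Complex.exp (2 * Real.pi * Complex.I * (∑ i, (n i : ℝ) * v i : ℝ))

theorem mFourier_coe {ι : Type*} [Fintype ι] (n : ι → ℤ) (v : ι → ℝ) :
    UnitAddTorus.mFourier n (fun i => (v i : UnitAddCircle)) = piChar n v := by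
  simp only [UnitAddTorus.mFourier, ContinuousMap.coe_mk, fourier_coe_apply, piChar]
  rw [← Complex.exp_sum]
  congr 1
  push_cast
  rw [Finset.mul_sum]
  refine Finset.sum_congr rfl fun i _ => ?_
  ring

theorem norm_piChar {ι : Type*} [Fintype ι] (n : ι → ℤ) (v : ι → ℝ) : ‖piChar n v‖ = 1 := by
  rw [piChar, Complex.norm_exp]
  simp

theorem continuous_piChar {ι : Type*} [Fintype ι] (n : ι → ℤ) : Continuous (piChar n) := by
  unfold piChar
  fun_prop

theorem piChar_add_int {ι : Type*} [Fintype ι] (n m : ι → ℤ) (v : ι → ℝ) :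
    piChar n (v + fun i => (m i : ℝ)) = piChar n v := by
  rw [← mFourier_coe, ← mFourier_coe]
  congr 1
  ext i
  simp

/-- **Poisson summation** on `ℤ^d`. -/
theorem hasSum_poisson {ι : Type*} [Fintype ι] {h : (ι → ℝ) → ℂ} (hi : Integrable h)
    (hcont : Continuous fun v : ι → ℝ => ∑' m : ι → ℤ, h (v + fun i => (m i : ℝ)))
    (hF : Summable fun n : ι → ℤ => ∫ w, piChar (-n) w * h w) (v : ι → ℝ) :
    HasSum (fun n : ι → ℤ => (∫ w, piChar (-n) w * h w) * piChar n v)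
      (∑' m : ι → ℤ, h (v + fun i => (m i : ℝ))) := by
  set G : (ι → ℝ) → ℂ := fun v => ∑' m : ι → ℤ, h (v + fun i => (m i : ℝ)) with hG
  have hper : ∀ (v : ι → ℝ) (m : ι → ℤ), G (v + fun i => (m i : ℝ)) = G v := fun v m => by
    simp only [hG]
    rw [← (Equiv.addLeft m).tsum_eq (fun k : ι → ℤ => h (v + fun i => (k i : ℝ)))]
    refine tsum_congr fun k => ?_
    congr 1
    ext i
    simp [add_assoc]
  have hq : IsOpenQuotientMap (Pi.map fun (_ : ι) (t : ℝ) => (t : UnitAddCircle)) :=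
    IsOpenQuotientMap.piMap fun _ => QuotientAddGroup.isOpenQuotientMap_mk
  -- The periodisation is moved to the torus by choosing representatives; by periodicity the choice
  -- does not matter. Continuity then descends along the open quotient map.
  have hlift : ∀ v : ι → ℝ,
      G (Function.surjInv hq.surjective fun i => (v i : UnitAddCircle)) = G v := fun v => by
    have h1 := Function.surjInv_eq hq.surjective fun i => (v i : UnitAddCircle)
    generalize Function.surjInv hq.surjective (fun i => (v i : UnitAddCircle)) = w at h1
    have h2 : ∀ i, ∃ k : ℤ, w i = v i + k := fun i => by
      have h3 : ((w i : ℝ) : UnitAddCircle) = v i := congrFun h1 i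
      have h4 : ((w i - v i : ℝ) : UnitAddCircle) = 0 := by
        rw [AddCircle.coe_sub, h3, sub_self]
      obtain ⟨k, hk⟩ := (AddCircle.coe_eq_zero_iff (1 : ℝ)).1 h4
      exact ⟨k, by simp at hk; linarith⟩
    choose k hk using h2
    rw [← hper v k]
    congr 1
    ext i
    exact hk i
  let F : C(UnitAddTorus ι, ℂ) := ⟨fun x => G (Function.surjInv hq.surjective x), by
    rw [hq.isQuotientMap.continuous_iff]
    exact hcont.congr fun v => (hlift v).symm⟩
  have hFv : ∀ v : ι → ℝ, F (fun i => (v i : UnitAddCircle)) = G v := hlift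
  -- Unfolding: since the character is periodic, the coefficient of the periodisation over one cell
  -- is the Fourier integral of `h` over the whole space.
  have hcoeff : ∀ n : ι → ℤ, UnitAddTorus.mFourierCoeff F n = ∫ w, piChar (-n) w * h w := by
    intro n
    have hint : Integrable fun w => piChar (-n) w * h w :=
      hi.bdd_mul (continuous_piChar _).aestronglyMeasurable
        (Eventually.of_forall fun v => (norm_piChar _ v).le)
    rw [UnitAddTorus.mFourierCoeff_eq_integral F n 0]
    have hcell : {x : ι → ℝ | ∀ i, x i ∈ Ioc ((0 : ι → ℝ) i) ((0 : ι → ℝ) i + 1)} =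
        unitCell (0 : ι → ℤ) := by
      ext v; simp [unitCell]
    rw [hcell]
    have hn := hasSum_integral_unitCell hint.norm
    have h1 := hasSum_integral_of_summable_integral_norm
      (μ := volume.restrict (unitCell (0 : ι → ℤ)))
      (F := fun (m : ι → ℤ) (v : ι → ℝ) => piChar (-n) (v + fun i => (m i : ℝ)) *
        h (v + fun i => (m i : ℝ)))
      (fun m => (hint.comp_add_right _).integrableOn) hn.summable
    rw [(hasSum_integral_unitCell hint).unique h1]
    refine integral_congr_ae (Eventually.of_forall fun v => ?_)
    simp only [piChar_add_int]
    rw [tsum_mul_left, hFv, mFourier_coe, smul_eq_mul]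
  have hsum : Summable (UnitAddTorus.mFourierCoeff F) := by
    rw [funext hcoeff]
    exact hF
  have := UnitAddTorus.hasSum_mFourier_series_apply_of_summable hsum
    (fun i => (v i : UnitAddCircle))
  simpa only [hcoeff, mFourier_coe, hFv, smul_eq_mul] using this

/-! ### Gaussians and the theta transformation for `A ℤ^d` -/

theorem measurableEmbedding_matrixMap {d : ℕ} {A : Matrix (Fin d) (Fin d) ℝ} (hA : A.det ≠ 0) :
    MeasurableEmbedding (matrixMap A) :=
  (matrixEquiv hA).toContinuousLinearEquiv.toHomeomorph.measurableEmbedding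

theorem map_matrixMap_volume {d : ℕ} {A : Matrix (Fin d) (Fin d) ℝ} (hA : A.det ≠ 0) :
    Measure.map (matrixMap A) volume =
      ENNReal.ofReal |A.det⁻¹| • (volume : Measure (EuclideanSpace ℝ (Fin d))) := by
  have h1 : (matrixMap A : (Fin d → ℝ) → _) = WithLp.toLp 2 ∘ Matrix.toLin' A := rfl
  rw [h1, ← Measure.map_map (PiLp.volume_preserving_toLp (Fin d)).measurable
    (Matrix.toLin' A).continuous_of_finiteDimensional.measurable,
    Real.map_matrix_volume_pi_eq_smul_volume_pi hA, Measure.map_smul,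
    (PiLp.volume_preserving_toLp (Fin d)).map_eq]

theorem integral_comp_matrixMap {d : ℕ} {A : Matrix (Fin d) (Fin d) ℝ} (hA : A.det ≠ 0)
    (f : EuclideanSpace ℝ (Fin d) → ℂ) :
    ∫ v, f (matrixMap A v) = (cellVolume A : ℂ)⁻¹ * ∫ w, f w := by
  rw [← (measurableEmbedding_matrixMap hA).integral_map, map_matrixMap_volume hA,
    integral_smul_measure, ENNReal.toReal_ofReal (abs_nonneg _), Complex.real_smul, cellVolume,
    abs_inv, Complex.ofReal_inv]

theorem integrable_comp_matrixMap {d : ℕ} {A : Matrix (Fin d) (Fin d) ℝ} (hA : A.det ≠ 0)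
    {f : EuclideanSpace ℝ (Fin d) → ℂ} (hf : Integrable f) :
    Integrable fun v => f (matrixMap A v) := by
  have := hf.smul_measure (c := ENNReal.ofReal |A.det⁻¹|) ENNReal.ofReal_ne_top
  rw [← map_matrixMap_volume hA] at this
  exact (measurableEmbedding_matrixMap hA).integrable_map_iff.1 this

/-- The wave `exp (-2πi y·z)`. -/
def planeWave {d : ℕ} (y z : EuclideanSpace ℝ (Fin d)) : ℂ :=
  Complex.exp (-(2 * Real.pi * Complex.I * (inner ℝ y z : ℝ)))

theorem norm_planeWave {d : ℕ} (y z : EuclideanSpace ℝ (Fin d)) : ‖planeWave y z‖ = 1 := by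
  rw [planeWave, Complex.norm_exp]
  simp

theorem planeWave_add_left {d : ℕ} (y y' z : EuclideanSpace ℝ (Fin d)) :
    planeWave (y + y') z = planeWave y z * planeWave y' z := by
  rw [planeWave, planeWave, planeWave, ← Complex.exp_add, inner_add_left]
  congr 1
  push_cast
  ring

theorem planeWave_comm {d : ℕ} (y z : EuclideanSpace ℝ (Fin d)) :
    planeWave y z = planeWave z y := by
  rw [planeWave, real_inner_comm, planeWave]

theorem planeWave_neg_right {d : ℕ} (y z : EuclideanSpace ℝ (Fin d)) :
    planeWave y (-z) = Complex.exp (2 * Real.pi * Complex.I * (inner ℝ y z : ℝ)) := by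
  rw [planeWave, inner_neg_right]
  congr 1
  push_cast
  ring

theorem planeWave_mul_planeWave_neg {d : ℕ} (y z : EuclideanSpace ℝ (Fin d)) :
    planeWave y z * planeWave y (-z) = 1 := by
  rw [planeWave, planeWave_neg_right, ← Complex.exp_add, neg_add_cancel, Complex.exp_zero]

theorem planeWave_sub_right {d : ℕ} (y z x : EuclideanSpace ℝ (Fin d)) :
    planeWave y (z - x) = planeWave y z * planeWave y (-x) := by
  rw [planeWave_comm, sub_eq_add_neg, planeWave_add_left, planeWave_comm z, planeWave_comm (-x)]

theorem continuous_planeWave_left {d : ℕ} (z : EuclideanSpace ℝ (Fin d)) :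
    Continuous fun y => planeWave y z := by
  unfold planeWave
  fun_prop

/-- A modulated Gaussian. -/
def waveGaussian {d : ℕ} (t : ℝ) (y w : EuclideanSpace ℝ (Fin d)) : ℂ :=
  (Real.exp (-(Real.pi * ‖w‖ ^ 2 * t)) : ℂ) * planeWave y w

theorem waveGaussian_eq {d : ℕ} (t : ℝ) (y w : EuclideanSpace ℝ (Fin d)) :
    waveGaussian t y w = Complex.exp (-((Real.pi * t : ℝ) : ℂ) * (‖w‖ : ℂ) ^ 2 +
      -(2 * Real.pi * Complex.I) * (inner ℝ y w : ℝ)) := by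
  rw [waveGaussian, planeWave, Complex.ofReal_exp, ← Complex.exp_add]
  congr 1
  push_cast
  ring

theorem norm_waveGaussian {d : ℕ} (t : ℝ) (y w : EuclideanSpace ℝ (Fin d)) :
    ‖waveGaussian t y w‖ = Real.exp (-(Real.pi * t * ‖w‖ ^ 2)) := by
  rw [waveGaussian, norm_mul, norm_planeWave, mul_one, Complex.norm_real, Real.norm_eq_abs,
    abs_of_pos (Real.exp_pos _)]
  congr 2
  ring

theorem integrable_waveGaussian {d : ℕ} {t : ℝ} (ht : 0 < t) (y : EuclideanSpace ℝ (Fin d)) :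
    Integrable (waveGaussian t y) := by
  rw [funext (waveGaussian_eq t y)]
  exact GaussianFourier.integrable_cexp_neg_mul_sq_norm_add
    (by rw [Complex.ofReal_re]; positivity) _ _

theorem integral_waveGaussian {d : ℕ} {t : ℝ} (ht : 0 < t) (y : EuclideanSpace ℝ (Fin d)) :
    ∫ w, waveGaussian t y w =
      ((t⁻¹ : ℝ) : ℂ) ^ ((d : ℂ) / 2) * (Real.exp (-(Real.pi * ‖y‖ ^ 2 * t⁻¹)) : ℂ) := by
  have hpi : (Real.pi : ℂ) ≠ 0 := by exact_mod_cast Real.pi_ne_zero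
  have ht' : (t : ℂ) ≠ 0 := by exact_mod_cast ht.ne'
  simp_rw [waveGaussian_eq]
  rw [GaussianFourier.integral_cexp_neg_mul_sq_norm_add
    (by rw [Complex.ofReal_re]; positivity), finrank_euclideanSpace, Fintype.card_fin,
    Complex.ofReal_exp]
  congr 2
  · push_cast
    field_simp
  · push_cast
    field_simp
    rw [Complex.I_sq]
    ring

/-- The transformation formula of theta series of lattices. -/
theorem hasSum_theta {d : ℕ} {A : Matrix (Fin d) (Fin d) ℝ} (hA : A.det ≠ 0) {t : ℝ} (ht : 0 < t)
    (x y : EuclideanSpace ℝ (Fin d)) :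
    HasSum (fun n : Fin d → ℤ => (cellVolume A : ℂ)⁻¹ * (((t⁻¹ : ℝ) : ℂ) ^ ((d : ℂ) / 2) *
        (Real.exp (-(Real.pi * ‖latticePoint A⁻¹.transpose n + y‖ ^ 2 * t⁻¹)) : ℂ)) *
        planeWave x (latticePoint A⁻¹.transpose n))
      (∑' n : Fin d → ℤ, waveGaussian t y (latticePoint A n - x)) := by
  have hadd : ∀ (v : Fin d → ℝ) (m : Fin d → ℤ),
      matrixMap A (v + fun i => (m i : ℝ)) = latticePoint A m - -matrixMap A v := fun v m => by
    rw [map_add, latticePoint]; abel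
  have hwave : ∀ (n : Fin d → ℤ) (v : Fin d → ℝ),
      piChar (-n) v = planeWave (latticePoint A⁻¹.transpose n) (matrixMap A v) := fun n v => by
    rw [planeWave, latticePoint, inner_matrixMap hA, piChar]
    simp only [Pi.neg_apply, Int.cast_neg, neg_mul, Finset.sum_neg_distrib, Complex.ofReal_neg]
    congr 1
    ring
  -- By duality the character of `n` is the plane wave of frequency `A^{-T} n`, so it only shifts
  -- the frequency of the Gaussian to `A^{-T} n + y`; the substitution `w = A v` contributes `1/V`.
  have hcoeff : ∀ n : Fin d → ℤ,
      ∫ w, piChar (-n) w * waveGaussian t y (matrixMap A w) = (cellVolume A : ℂ)⁻¹ *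
        (((t⁻¹ : ℝ) : ℂ) ^ ((d : ℂ) / 2) *
        (Real.exp (-(Real.pi * ‖latticePoint A⁻¹.transpose n + y‖ ^ 2 * t⁻¹)) : ℂ)) := fun n => by
    rw [← integral_waveGaussian ht, ← integral_comp_matrixMap hA]
    refine integral_congr_ae (Eventually.of_forall fun v => ?_)
    simp only
    rw [hwave, waveGaussian, waveGaussian, planeWave_add_left]
    ring
  have hcont : Continuous fun v : Fin d → ℝ =>
      ∑' m : Fin d → ℤ, waveGaussian t y (matrixMap A (v + fun i => (m i : ℝ))) := by
    rw [continuous_iff_continuousAt]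
    intro v
    set R := ‖matrixMap A v‖ + 1 with hR
    have hopen : IsOpen {v : Fin d → ℝ | ‖matrixMap A v‖ < R} :=
      isOpen_lt (continuous_matrixMap A).norm continuous_const
    refine ContinuousOn.continuousAt (s := {v : Fin d → ℝ | ‖matrixMap A v‖ < R}) ?_
      (hopen.mem_nhds (by simp [hR]))
    refine continuousOn_tsum (u := fun m => Real.exp (Real.pi * t * R ^ 2) *
        Real.exp (-(Real.pi * t / 2 * ‖latticePoint A m - 0‖ ^ 2)))
      (fun m => ?_) ((summable_exp_neg_norm_sq hA 0 (by positivity)).mul_left _) fun m w hw => ?_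
    · have := continuous_matrixMap A
      unfold waveGaussian planeWave
      fun_prop
    · rw [norm_waveGaussian, ← Real.exp_add, sub_zero]
      refine Real.exp_le_exp.2 ?_
      have hw' : ‖matrixMap A w‖ < R := hw
      have h1 : ‖latticePoint A m‖ ≤ ‖matrixMap A (w + fun i => (m i : ℝ))‖ + R := by
        have : latticePoint A m = matrixMap A (w + fun i => (m i : ℝ)) - matrixMap A w := by
          rw [map_add, latticePoint]; abel
        rw [this]
        exact (norm_sub_le _ _).trans (by linarith)
      -- From `(r + R)² ≤ 2 (r² + R²)`: half of the decay rate survives, at the price of the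
      -- constant `exp(π t R²)`, uniformly on the region `|A v| < R`.
      have h2 : ‖latticePoint A m‖ ^ 2 ≤
          2 * (‖matrixMap A (w + fun i => (m i : ℝ))‖ ^ 2 + R ^ 2) :=
        (pow_le_pow_left₀ (norm_nonneg _) h1 2).trans (add_sq_le.trans_eq (by ring))
      have h3 := mul_le_mul_of_nonneg_left h2 (by positivity : 0 ≤ Real.pi * t / 2)
      linarith
  have hF : Summable fun n : Fin d → ℤ =>
      ∫ w, piChar (-n) w * waveGaussian t y (matrixMap A w) := by
    simp_rw [hcoeff]
    refine Summable.mul_left _ (Summable.mul_left _ ?_)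
    have := summable_exp_neg_norm_sq (det_inv_transpose_ne_zero hA) (-y)
      (c := Real.pi * t⁻¹) (by positivity)
    refine (Complex.hasSum_ofReal.2 this.hasSum).summable.congr fun n => ?_
    rw [sub_neg_eq_add]
    congr 3
    ring
  -- Evaluation at `v = A⁻¹ (-x)`, so that `A (v + m) = A m - x`.
  have h := hasSum_poisson (integrable_comp_matrixMap hA (integrable_waveGaussian ht y)) hcont hF
    ((matrixEquiv hA).symm (-x))
  have hx : matrixMap A ((matrixEquiv hA).symm (-x)) = -x := (matrixEquiv hA).apply_symm_apply _
  simp only [hadd, hx, neg_neg] at h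
  refine h.congr_fun fun n => ?_
  rw [hcoeff]
  congr 1
  have := hwave (-n) ((matrixEquiv hA).symm (-x))
  rw [neg_neg, hx] at this
  rw [this, latticePoint_neg, planeWave_comm, planeWave, planeWave, inner_neg_neg]

/-! ### Crandall's representation for `Re ν > d` -/

theorem ofReal_cpow_eq_exp {p : ℝ} (hp : 0 < p) (w : ℂ) :
    (p : ℂ) ^ w = Complex.exp (Real.log p * w) := by
  rw [Complex.cpow_def_of_ne_zero (by exact_mod_cast hp.ne'), Complex.ofReal_log hp.le]

theorem integrableOn_gammaKernel_Ioc {s : ℂ} (hs : 0 < s.re) {a : ℝ} (ha : 0 ≤ a) :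
    IntegrableOn (gammaKernel s a) (Ioc 0 1) := by
  have h := (intervalIntegral.intervalIntegrable_rpow' (a := 0) (b := 1) (r := s.re - 1)
    (by linarith)).1
  refine Integrable.mono' h (((continuousOn_gammaKernel s a).mono
    Ioc_subset_Ioi_self).aestronglyMeasurable measurableSet_Ioc) ?_
  filter_upwards [ae_restrict_mem measurableSet_Ioc] with t ht
  rw [norm_gammaKernel s a ht.1]
  exact mul_le_of_le_one_right (Real.rpow_nonneg ht.1.le _)
    (Real.exp_le_one_iff.2 (by have := mul_nonneg ha ht.1.le; linarith))

/-- The upper Crandall function complements the integral over `(0, 1]` to a power of the norm. -/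
theorem upperCrandall_add_integral {d : ℕ} {ν : ℂ} (hν : 0 < ν.re)
    (z : EuclideanSpace ℝ (Fin d)) :
    upperCrandall ν z + ∫ t in Ioc (0 : ℝ) 1, gammaKernel (ν / 2) (Real.pi * ‖z‖ ^ 2) t =
      if z = 0 then 0 else
        Complex.Gamma (ν / 2) * (Real.pi : ℂ) ^ (-ν / 2) * (‖z‖ : ℂ) ^ (-ν) := by
  have hs : 0 < (ν / 2).re := by simpa using hν
  have hν0 : ν ≠ 0 := fun h => by simp [h] at hν
  split_ifs with hz
  -- At the origin the integral is `∫_0^1 t^(ν/2 - 1) dt = 2/ν`, which the convention `G_ν(0) =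
  -- -2/ν` cancels.
  · have h1 : ∫ t in Ioc (0 : ℝ) 1, gammaKernel (ν / 2) (Real.pi * ‖z‖ ^ 2) t =
        ∫ t in (0 : ℝ)..1, (t : ℂ) ^ (ν / 2 - 1) := by
      rw [intervalIntegral.integral_of_le zero_le_one]
      refine setIntegral_congr_fun measurableSet_Ioc fun t _ => ?_
      simp [gammaKernel, hz]
    have hν2 : ν / 2 ≠ 0 := div_ne_zero hν0 two_ne_zero
    rw [h1, integral_cpow (Or.inl (by simpa using hs)), upperCrandall, if_pos hz, sub_add_cancel,
      Complex.ofReal_one, Complex.one_cpow, Complex.ofReal_zero, Complex.zero_cpow hν2]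
    field_simp
    ring
  · have ha : 0 < Real.pi * ‖z‖ ^ 2 := by positivity
    have hzn : 0 < ‖z‖ := norm_pos_iff.2 hz
    have h1 := Complex.integral_cpow_mul_exp_neg_mul_Ioi hs ha
    have h2 : ∫ t in Ioi (0 : ℝ), gammaKernel (ν / 2) (Real.pi * ‖z‖ ^ 2) t =
        (1 / ((Real.pi * ‖z‖ ^ 2 : ℝ) : ℂ)) ^ (ν / 2) * Complex.Gamma (ν / 2) := by
      rw [← h1]
      refine setIntegral_congr_fun measurableSet_Ioi fun t _ => ?_
      simp [gammaKernel]
    rw [upperCrandall_of_ne ν hz, expIntegral, add_comm, ← setIntegral_union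
      (Ioc_disjoint_Ioi le_rfl) measurableSet_Ioi (integrableOn_gammaKernel_Ioc hs ha.le)
      (integrableOn_gammaKernel _ ha), Ioc_union_Ioi_eq_Ioi zero_le_one, h2]
    have h3 : (1 / ((Real.pi * ‖z‖ ^ 2 : ℝ) : ℂ)) ^ (ν / 2) =
        (Real.pi : ℂ) ^ (-ν / 2) * (‖z‖ : ℂ) ^ (-ν) := by
      rw [one_div, ← Complex.ofReal_inv, ofReal_cpow_eq_exp (by positivity),
        ofReal_cpow_eq_exp Real.pi_pos, ofReal_cpow_eq_exp hzn, ← Complex.exp_add, Real.log_inv,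
        Real.log_mul Real.pi_ne_zero (by positivity), Real.log_pow]
      congr 1
      push_cast
      ring
    rw [h3]
    ring

/-- Upper Crandall functions decay like Gaussians away from `0`, locally uniformly in the
exponent. -/
theorem exists_norm_upperCrandall_le (R : ℝ) {δ : ℝ} (hδ : 0 < δ) :
    ∃ C : ℝ, 0 ≤ C ∧ ∀ ν : ℂ, ν.re ≤ R → ∀ (d : ℕ) (z : EuclideanSpace ℝ (Fin d)), δ ≤ ‖z‖ →
      ‖upperCrandall ν z‖ ≤ C * Real.exp (-(Real.pi / 2 * ‖z‖ ^ 2)) := by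
  obtain ⟨C, hC, h⟩ := exists_norm_expIntegral_le (R / 2) (δ := Real.pi * δ ^ 2) (by positivity)
  refine ⟨C, hC, fun ν hν d z hz => ?_⟩
  have hz0 : z ≠ 0 := norm_pos_iff.1 (hδ.trans_le hz)
  rw [upperCrandall_of_ne ν hz0]
  refine (h (ν / 2) (by simpa using by linarith) (Real.pi * ‖z‖ ^ 2) (by gcongr)).trans_eq ?_
  congr 3
  ring

/-- Sums of upper Crandall functions over shifted lattices converge absolutely. -/
theorem summable_norm_upperCrandall {d : ℕ} {A : Matrix (Fin d) (Fin d) ℝ} (hA : A.det ≠ 0)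
    (x : EuclideanSpace ℝ (Fin d)) (ν : ℂ) :
    Summable fun n : Fin d → ℤ => ‖upperCrandall ν (latticePoint A n - x)‖ := by
  obtain ⟨δ, hδ, hle⟩ := exists_le_norm_latticePoint_sub hA x
  obtain ⟨C, -, hC⟩ := exists_norm_upperCrandall_le ν.re hδ
  refine ((summable_exp_neg_norm_sq hA x (c := Real.pi / 2)
    (by positivity)).mul_left C).of_norm_bounded_eventually ?_
  refine (finite_latticePoint_eq hA x).subset fun n hn => ?_
  contrapose! hn
  simp only [mem_compl_iff, mem_ofPred_eq, not_le, not_lt] at hn ⊢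
  rw [norm_norm]
  exact hC ν le_rfl d _ (hle n hn)

/-- The terms of the Dirichlet series of the Epstein zeta function. -/
def epsteinTerm {d : ℕ} (ν : ℂ) (y z : EuclideanSpace ℝ (Fin d)) : ℂ :=
  if z = 0 then 0 else (‖z‖ : ℂ) ^ (-ν) * planeWave y z

theorem norm_epsteinTerm_le {d : ℕ} (ν : ℂ) (y z : EuclideanSpace ℝ (Fin d)) :
    ‖epsteinTerm ν y z‖ ≤ ‖z‖ ^ (-ν.re) := by
  rw [epsteinTerm]
  split_ifs with hz
  · rw [norm_zero]; positivity
  · rw [norm_mul, norm_planeWave, mul_one,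
      Complex.norm_cpow_eq_rpow_re_of_pos (norm_pos_iff.2 hz), Complex.neg_re]

theorem summable_epsteinTerm {d : ℕ} {A : Matrix (Fin d) (Fin d) ℝ} (hA : A.det ≠ 0)
    (x y : EuclideanSpace ℝ (Fin d)) {ν : ℂ} (hν : (d : ℝ) < ν.re) :
    Summable fun n : Fin d → ℤ => epsteinTerm ν y (latticePoint A n - x) :=
  (summable_norm_latticePoint_sub_rpow hA x (r := -ν.re) (by linarith)).of_norm_bounded
    fun _ => norm_epsteinTerm_le _ _ _

/-- One summand of the Dirichlet series, with its Mellin integral split at `t = 1`; the phase does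
not depend on `t` and factors out. -/
theorem upperCrandall_mul_planeWave_add {d : ℕ} {ν : ℂ} (hν : 0 < ν.re)
    (y z : EuclideanSpace ℝ (Fin d)) :
    upperCrandall ν z * planeWave y z +
      ∫ t in Ioc (0 : ℝ) 1, (t : ℂ) ^ (ν / 2 - 1) * waveGaussian t y z =
      Complex.Gamma (ν / 2) * (Real.pi : ℂ) ^ (-ν / 2) * epsteinTerm ν y z := by
  have h : ∫ t in Ioc (0 : ℝ) 1, (t : ℂ) ^ (ν / 2 - 1) * waveGaussian t y z =
      (∫ t in Ioc (0 : ℝ) 1, gammaKernel (ν / 2) (Real.pi * ‖z‖ ^ 2) t) * planeWave y z := by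
    rw [← integral_mul_const]
    simp only [gammaKernel, waveGaussian, mul_assoc]
  rw [h, ← add_mul, upperCrandall_add_integral hν, epsteinTerm]
  split_ifs <;> ring

theorem norm_cpow_mul_waveGaussian {d : ℕ} (s : ℂ) {t : ℝ} (ht : 0 < t)
    (y z : EuclideanSpace ℝ (Fin d)) :
    ‖(t : ℂ) ^ (s - 1) * waveGaussian t y z‖ = ‖gammaKernel s (Real.pi * ‖z‖ ^ 2) t‖ := by
  rw [norm_gammaKernel _ _ ht, norm_mul, Complex.norm_cpow_eq_rpow_re_of_pos ht, norm_waveGaussian,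
    mul_right_comm Real.pi t, Complex.sub_re, Complex.one_re]

theorem integrableOn_cpow_mul_waveGaussian {d : ℕ} {s : ℂ} {S : Set ℝ} (y z : EuclideanSpace ℝ (Fin d))
    (h : IntegrableOn (gammaKernel s (Real.pi * ‖z‖ ^ 2)) S) :
    IntegrableOn (fun t : ℝ => (t : ℂ) ^ (s - 1) * waveGaussian t y z) S := by
  have h' : IntegrableOn (fun t => gammaKernel s (Real.pi * ‖z‖ ^ 2) t * planeWave y z) S :=
    h.mul_const _
  simpa only [gammaKernel, waveGaussian, mul_assoc] using h'

/-- Exchange of sum and integral over `(0, 1]` for theta series. -/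
theorem hasSum_integral_Ioc_waveGaussian {d : ℕ} {A : Matrix (Fin d) (Fin d) ℝ} (hA : A.det ≠ 0)
    (x y : EuclideanSpace ℝ (Fin d)) {ν : ℂ} (hν : (d : ℝ) < ν.re) :
    HasSum (fun n : Fin d → ℤ => ∫ t in Ioc (0 : ℝ) 1,
        (t : ℂ) ^ (ν / 2 - 1) * waveGaussian t y (latticePoint A n - x))
      (∫ t in Ioc (0 : ℝ) 1, (t : ℂ) ^ (ν / 2 - 1) *
        ∑' n : Fin d → ℤ, waveGaussian t y (latticePoint A n - x)) := by
  have hν0 : 0 < ν.re := d.cast_nonneg.trans_lt hν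
  have hs : 0 < (ν / 2).re := by simpa using hν0
  simp_rw [← tsum_mul_left]
  refine hasSum_integral_of_summable_integral_norm (fun n => integrableOn_cpow_mul_waveGaussian _ _
    (integrableOn_gammaKernel_Ioc hs (by positivity))) ?_
  have hν' : (d : ℝ) < ((ν.re : ℝ) : ℂ).re := by simpa using hν
  -- The integrals of the norms are the same integrals at the real exponent `Re ν` and `y = 0`.
  -- There the pointwise splitting writes them as a Dirichlet term minus a Crandall function, both
  -- summable.
  have h1 := ((summable_epsteinTerm hA x 0 hν').mul_left
    (Complex.Gamma ((ν.re : ℝ) / 2) * (Real.pi : ℂ) ^ (-((ν.re : ℝ) : ℂ) / 2))).sub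
    ((summable_norm_upperCrandall hA x (ν.re : ℝ)).of_norm)
  refine (Complex.hasSum_re h1.hasSum).summable.congr fun n => ?_
  set z := latticePoint A n - x
  have h2 := upperCrandall_mul_planeWave_add (ν := (ν.re : ℝ)) (by simpa using hν0) 0 z
  have h3 : planeWave 0 z = 1 := by simp [planeWave]
  rw [← h2, h3, mul_one, add_sub_cancel_left]
  rw [← Complex.ofReal_re (∫ t in Ioc (0 : ℝ) 1, _), ← integral_complex_ofReal]
  congr 1
  refine setIntegral_congr_fun measurableSet_Ioc fun t ht => ?_
  rw [norm_cpow_mul_waveGaussian _ ht.1, norm_gammaKernel _ _ ht.1, waveGaussian, h3, mul_one,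
    Complex.ofReal_mul, Complex.ofReal_cpow ht.1.le]
  simp

/-- Exchange of sum and integral over `(1, ∞)` for theta series without constant term. -/
theorem hasSum_integral_Ioi_waveGaussian {d : ℕ} {A : Matrix (Fin d) (Fin d) ℝ} (hA : A.det ≠ 0)
    {x : EuclideanSpace ℝ (Fin d)} (hx : ∀ n, latticePoint A n ≠ x) (c : (Fin d → ℤ) → ℂ)
    (hc : ∀ n, ‖c n‖ ≤ 1) (μ : ℂ) :
    HasSum (fun n : Fin d → ℤ => upperCrandall μ (latticePoint A n - x) * c n)
      (∫ t in Ioi (1 : ℝ), (t : ℂ) ^ (μ / 2 - 1) *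
        ∑' n : Fin d → ℤ, (Real.exp (-(Real.pi * ‖latticePoint A n - x‖ ^ 2 * t)) : ℂ) * c n) := by
  obtain ⟨δ, hδ, hle⟩ := exists_le_norm_latticePoint_sub hA x
  obtain ⟨C, hC0, hC⟩ := exists_integral_norm_gammaKernel_le (μ / 2).re
    (δ := Real.pi * δ ^ 2) (by positivity)
  have hpos : ∀ n, 0 < Real.pi * ‖latticePoint A n - x‖ ^ 2 := fun n => by
    have := norm_pos_iff.2 (sub_ne_zero.2 (hx n))
    positivity
  have hterm : ∀ n, upperCrandall μ (latticePoint A n - x) * c n = ∫ t in Ioi (1 : ℝ),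
      (t : ℂ) ^ (μ / 2 - 1) *
        ((Real.exp (-(Real.pi * ‖latticePoint A n - x‖ ^ 2 * t)) : ℂ) * c n) := fun n => by
    rw [upperCrandall_of_ne μ (sub_ne_zero.2 (hx n)), expIntegral, ← integral_mul_const]
    simp only [gammaKernel, mul_assoc]
  simp_rw [hterm, ← tsum_mul_left]
  have hk : ∀ (n : Fin d → ℤ) (t : ℝ), (t : ℂ) ^ (μ / 2 - 1) *
      ((Real.exp (-(Real.pi * ‖latticePoint A n - x‖ ^ 2 * t)) : ℂ) * c n) =
      gammaKernel (μ / 2) (Real.pi * ‖latticePoint A n - x‖ ^ 2) t * c n := fun n t => by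
    rw [gammaKernel]
    exact (mul_assoc _ _ _).symm
  simp_rw [hk]
  refine hasSum_integral_of_summable_integral_norm
    (fun n => (integrableOn_gammaKernel _ (hpos n)).mul_const _) ?_
  refine ((summable_exp_neg_norm_sq hA x (c := Real.pi / 2) (by positivity)).mul_left
    C).of_nonneg_of_le (fun n => integral_nonneg fun t => norm_nonneg _) fun n => ?_
  simp_rw [norm_mul]
  rw [integral_mul_const]
  refine (mul_le_of_le_one_right (integral_nonneg fun t => norm_nonneg _) (hc n)).trans ?_
  refine (hC (μ / 2) le_rfl _ (mul_le_mul_of_nonneg_left (pow_le_pow_left₀ hδ.le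
    (hle n (hx n)) 2) Real.pi_pos.le)).trans_eq ?_
  congr 3
  ring

/-- The inversion `t ↦ 1/t` in Mellin form, applied to `F` cut off to `(1, ∞)`. The endpoint `t = 1`
is a null set. -/
theorem integral_Ioc_comp_inv (F : ℝ → ℂ) (s : ℂ) :
    ∫ t in Ioc (0 : ℝ) 1, (t : ℂ) ^ (s - 1) * F t⁻¹ =
      ∫ t in Ioi (1 : ℝ), (t : ℂ) ^ (-s - 1) * F t := by
  have h := mellin_comp_inv ((Ioi (1 : ℝ)).indicator F) s
  rw [mellin, mellin] at h
  rw [integral_Ioc_eq_integral_Ioo]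
  have h1 : Ioo (0 : ℝ) 1 = Ioi 0 ∩ Iio 1 := rfl
  have h2 : Ioi (1 : ℝ) = Ioi 0 ∩ Ioi 1 := by
    rw [Ioi_inter_Ioi]; simp
  rw [h1, h2, ← setIntegral_indicator measurableSet_Iio, ← setIntegral_indicator measurableSet_Ioi]
  refine Eq.trans ?_ (h.trans ?_)
  · refine setIntegral_congr_fun measurableSet_Ioi fun t ht => ?_
    have ht0 : (0 : ℝ) < t := ht
    by_cases h1 : t < 1
    · have : 1 < t⁻¹ := (one_lt_inv₀ ht0).2 h1
      simp [h1, this]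
    · have : ¬ 1 < t⁻¹ := fun h => h1 ((one_lt_inv₀ ht0).1 h)
      simp [h1, this]
  · refine setIntegral_congr_fun measurableSet_Ioi fun t ht => ?_
    by_cases h1 : 1 < t <;> simp [h1]

/-- The Crandall representation of the Epstein zeta function in the half plane of convergence. -/
theorem crandall_representation {d : ℕ} {A : Matrix (Fin d) (Fin d) ℝ} (hA : A.det ≠ 0)
    (x : EuclideanSpace ℝ (Fin d)) {y : EuclideanSpace ℝ (Fin d)}
    (hy : ∀ n, latticePoint A⁻¹.transpose n ≠ -y) {ν : ℂ} (hν : (d : ℝ) < ν.re) :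
    Complex.Gamma (ν / 2) * (Real.pi : ℂ) ^ (-ν / 2) *
        ∑' n : Fin d → ℤ, epsteinTerm ν y (latticePoint A n - x) =
      (∑' n : Fin d → ℤ,
        upperCrandall ν (latticePoint A n - x) * planeWave y (latticePoint A n - x)) +
      (cellVolume A : ℂ)⁻¹ * ∑' n : Fin d → ℤ,
        upperCrandall (d - ν) (latticePoint A⁻¹.transpose n + y) *
          planeWave x (latticePoint A⁻¹.transpose n) := by
  have hν0 : 0 < ν.re := d.cast_nonneg.trans_lt hν
  have hI := hasSum_integral_Ioc_waveGaussian hA x y hν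
  have hG : Summable fun n : Fin d → ℤ =>
      upperCrandall ν (latticePoint A n - x) * planeWave y (latticePoint A n - x) := by
    refine Summable.of_norm ?_
    simpa only [norm_mul, norm_planeWave, mul_one] using summable_norm_upperCrandall hA x ν
  rw [← tsum_mul_left]
  simp_rw [← upperCrandall_mul_planeWave_add hν0]
  rw [hG.tsum_add hI.summable, hI.tsum_eq]
  congr 1
  have hK := hasSum_integral_Ioi_waveGaussian (det_inv_transpose_ne_zero hA) hy
    (fun n => planeWave x (latticePoint A⁻¹.transpose n)) (fun n => (norm_planeWave _ _).le) (d - ν)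
  simp only [sub_neg_eq_add] at hK
  rw [hK.tsum_eq]
  have h1 := integral_Ioc_comp_inv (fun u => (cellVolume A : ℂ)⁻¹ * ((u : ℂ) ^ ((d : ℂ) / 2) *
    ∑' n : Fin d → ℤ, (Real.exp (-(Real.pi * ‖latticePoint A⁻¹.transpose n + y‖ ^ 2 * u)) : ℂ) *
      planeWave x (latticePoint A⁻¹.transpose n))) (ν / 2)
  rw [← integral_const_mul]
  refine Eq.trans ?_ (h1.trans ?_)
  -- The theta transformation at each `t` in `(0, 1]` expresses the integrand through `u = 1/t`.
  · refine setIntegral_congr_fun measurableSet_Ioc fun t ht => ?_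
    have hT := (hasSum_theta hA ht.1 x y).tsum_eq
    rw [← hT]
    refine congrArg _ ?_
    rw [← tsum_mul_left, ← tsum_mul_left]
    refine tsum_congr fun n => ?_
    ring
  · refine setIntegral_congr_fun measurableSet_Ioi fun t ht => ?_
    have ht0 : (t : ℂ) ≠ 0 := by exact_mod_cast (zero_lt_one.trans ht).ne'
    -- The weight `u^(d/2)` of the theta transformation turns the inverted exponent `-ν/2` into `(d
    -- - ν)/2`.
    rw [show (d - ν) / 2 - 1 = (-(ν / 2) - 1) + (d : ℂ) / 2 by ring, Complex.cpow_add _ _ ht0]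
    ring

/-! ### Analytic continuation in `ν` -/

theorem differentiable_upperCrandall {d : ℕ} {z : EuclideanSpace ℝ (Fin d)} (hz : z ≠ 0) :
    Differentiable ℂ fun ν : ℂ => upperCrandall ν z := by
  simp_rw [upperCrandall_of_ne _ hz]
  exact (differentiable_expIntegral (by positivity)).comp (differentiable_id.div_const 2)

/-- The upper Crandall function, with the value `0` at the origin. -/
def puncturedCrandall {d : ℕ} (ν : ℂ) (z : EuclideanSpace ℝ (Fin d)) : ℂ :=
  if z = 0 then 0 else upperCrandall ν z

/-- Sums of upper Crandall functions over a shifted lattice are entire in the exponent. -/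
theorem differentiable_tsum_puncturedCrandall {d : ℕ} {A : Matrix (Fin d) (Fin d) ℝ}
    (hA : A.det ≠ 0) (x : EuclideanSpace ℝ (Fin d)) (c : (Fin d → ℤ) → ℂ)
    (hc : ∀ n, ‖c n‖ ≤ 1) :
    Differentiable ℂ fun ν : ℂ =>
      ∑' n : Fin d → ℤ, puncturedCrandall ν (latticePoint A n - x) * c n := by
  intro ν
  obtain ⟨δ, hδ, hle⟩ := exists_le_norm_latticePoint_sub hA x
  obtain ⟨C, hC0, hC⟩ := exists_norm_upperCrandall_le (ν.re + 1) hδ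
  have hopen : IsOpen {w : ℂ | w.re < ν.re + 1} := isOpen_lt Complex.continuous_re continuous_const
  refine DifferentiableOn.differentiableAt (s := {w : ℂ | w.re < ν.re + 1})
    (Complex.differentiableOn_tsum_of_summable_norm ((summable_exp_neg_norm_sq hA x (c := Real.pi / 2)
      (by positivity)).mul_left C) (fun n => ?_) hopen fun n w hw => ?_)
    (hopen.mem_nhds (by simp))
  · refine Differentiable.differentiableOn ?_
    unfold puncturedCrandall
    by_cases h : latticePoint A n - x = 0
    · simp [h]
    · simpa [h] using (differentiable_upperCrandall h).mul_const (c n)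
  · have hw' : w.re ≤ ν.re + 1 := le_of_lt hw
    rw [norm_mul]
    refine (mul_le_of_le_one_right (norm_nonneg _) (hc n)).trans ?_
    rw [puncturedCrandall]
    split_ifs with h
    · rw [norm_zero]; positivity
    · exact hC w hw' d _ (hle n (sub_ne_zero.1 h))

/-- Crandall's series without the summand `z = x`. -/
def crandallSeries {d : ℕ} (A : Matrix (Fin d) (Fin d) ℝ) (x y : EuclideanSpace ℝ (Fin d))
    (ν : ℂ) : ℂ :=
  (∑' n : Fin d → ℤ,
    puncturedCrandall ν (latticePoint A n - x) * planeWave y (latticePoint A n - x)) +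
  (cellVolume A : ℂ)⁻¹ * ∑' n : Fin d → ℤ,
    puncturedCrandall (d - ν) (latticePoint A⁻¹.transpose n + y) *
      planeWave x (latticePoint A⁻¹.transpose n)

open Classical in
/-- The entire continuation of `∑_{z ∈ Λ, z ≠ x} exp(-2πi y·(z - x)) / |z - x|^ν`. -/
def epsteinEntire {d : ℕ} (A : Matrix (Fin d) (Fin d) ℝ) (x y : EuclideanSpace ℝ (Fin d))
    (ν : ℂ) : ℂ :=
  (Real.pi : ℂ) ^ (ν / 2) * (crandallSeries A x y ν * (Complex.Gamma (ν / 2))⁻¹ -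
    if x ∈ epsteinLattice A then (Complex.Gamma (ν / 2 + 1))⁻¹ else 0)

theorem differentiable_crandallSeries {d : ℕ} {A : Matrix (Fin d) (Fin d) ℝ} (hA : A.det ≠ 0)
    (x y : EuclideanSpace ℝ (Fin d)) : Differentiable ℂ (crandallSeries A x y) := by
  have h1 := differentiable_tsum_puncturedCrandall hA x
    (fun n => planeWave y (latticePoint A n - x)) fun n => (norm_planeWave _ _).le
  have h2 := (differentiable_tsum_puncturedCrandall (det_inv_transpose_ne_zero hA) (-y)
    (fun n => planeWave x (latticePoint A⁻¹.transpose n)) fun n => (norm_planeWave _ _).le).comp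
    ((differentiable_const (d : ℂ)).sub differentiable_id)
  simp only [sub_neg_eq_add] at h2
  exact h1.add (h2.const_mul _)

theorem differentiable_epsteinEntire {d : ℕ} {A : Matrix (Fin d) (Fin d) ℝ} (hA : A.det ≠ 0)
    (x y : EuclideanSpace ℝ (Fin d)) : Differentiable ℂ (epsteinEntire A x y) := by
  have hpi : (Real.pi : ℂ) ≠ 0 := by exact_mod_cast Real.pi_ne_zero
  have h2 : Differentiable ℂ fun ν : ℂ => ν / 2 := differentiable_id.div_const 2
  have hG : Differentiable ℂ fun ν : ℂ => (Complex.Gamma (ν / 2))⁻¹ :=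
    Complex.differentiable_one_div_Gamma.comp h2
  have hG1 : Differentiable ℂ fun ν : ℂ => (Complex.Gamma (ν / 2 + 1))⁻¹ :=
    Complex.differentiable_one_div_Gamma.comp (h2.add_const 1)
  refine (h2.const_cpow (Or.inl hpi)).mul (((differentiable_crandallSeries hA x y).mul hG).sub ?_)
  split_ifs
  · exact hG1
  · exact differentiable_const 0

theorem ne_neg_of_notMem_reciprocalLattice {d : ℕ} {A : Matrix (Fin d) (Fin d) ℝ}
    {y : EuclideanSpace ℝ (Fin d)} (hy : y ∉ reciprocalLattice A) (n : Fin d → ℤ) :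
    latticePoint A⁻¹.transpose n ≠ -y := fun h =>
  hy ⟨-n, by
    have := latticePoint_neg A⁻¹.transpose n
    rw [h, neg_neg] at this
    exact this⟩

/-- Up to sign this is the summand at `z = x` after division by `Γ(ν/2)`. The right side is entire,
so the apparent pole at `ν = 0` disappears once this form is used. -/
theorem one_div_two_mul_Gamma_inv {ν : ℂ} (hν : ν ≠ 0) :
    2 / ν * (Complex.Gamma (ν / 2))⁻¹ = (Complex.Gamma (ν / 2 + 1))⁻¹ := by
  rw [Complex.Gamma_add_one _ (div_ne_zero hν two_ne_zero), mul_inv, inv_div]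

open Classical in
/-- Crandall's series with the summand at `z = x`. -/
theorem tsum_upperCrandall_eq {d : ℕ} {A : Matrix (Fin d) (Fin d) ℝ} (hA : A.det ≠ 0)
    (x y : EuclideanSpace ℝ (Fin d)) (ν : ℂ) :
    ∑' n : Fin d → ℤ,
        upperCrandall ν (latticePoint A n - x) * planeWave y (latticePoint A n - x) =
      (∑' n : Fin d → ℤ,
        puncturedCrandall ν (latticePoint A n - x) * planeWave y (latticePoint A n - x)) +
      if x ∈ epsteinLattice A then -2 / ν else 0 := by
  have hG : Summable fun n : Fin d → ℤ =>
      upperCrandall ν (latticePoint A n - x) * planeWave y (latticePoint A n - x) := by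
    refine Summable.of_norm ?_
    simpa only [norm_mul, norm_planeWave, mul_one] using summable_norm_upperCrandall hA x ν
  split_ifs with hx
  · obtain ⟨m, hm⟩ := hx
    change latticePoint A m = x at hm
    rw [hG.tsum_eq_add_tsum_ite m, add_comm]
    congr 1
    · refine tsum_congr fun n => ?_
      have : latticePoint A n - x = 0 ↔ n = m := by
        rw [sub_eq_zero, ← hm]; exact (latticePoint_injective hA).eq_iff
      simp only [puncturedCrandall, this]
      split_ifs <;> simp
    · rw [hm, sub_self, upperCrandall, if_pos rfl]
      simp [planeWave]
  · rw [add_zero]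
    refine tsum_congr fun n => ?_
    have : latticePoint A n - x ≠ 0 := fun h => hx ⟨n, sub_eq_zero.1 h⟩
    rw [puncturedCrandall, if_neg this]

open Classical in
theorem epsteinEntire_eq_tsum {d : ℕ} {A : Matrix (Fin d) (Fin d) ℝ} (hA : A.det ≠ 0)
    (x : EuclideanSpace ℝ (Fin d)) {y : EuclideanSpace ℝ (Fin d)}
    (hy : y ∉ reciprocalLattice A) {ν : ℂ} (hν : (d : ℝ) < ν.re) :
    epsteinEntire A x y ν = ∑' n : Fin d → ℤ, epsteinTerm ν y (latticePoint A n - x) := by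
  have hν0 : 0 < ν.re := d.cast_nonneg.trans_lt hν
  have hne : ν ≠ 0 := fun h => by simp [h] at hν0
  have hG : Complex.Gamma (ν / 2) ≠ 0 :=
    Complex.Gamma_ne_zero_of_re_pos (by simpa using hν0)
  have hpi : (Real.pi : ℂ) ^ (ν / 2) * (Real.pi : ℂ) ^ (-ν / 2) = 1 := by
    rw [← Complex.cpow_add _ _ (by exact_mod_cast Real.pi_ne_zero), neg_div, add_neg_cancel,
      Complex.cpow_zero]
  have h := crandall_representation hA x (ne_neg_of_notMem_reciprocalLattice hy) hν
  have hq : ∀ n, puncturedCrandall (d - ν) (latticePoint A⁻¹.transpose n + y) =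
      upperCrandall (d - ν) (latticePoint A⁻¹.transpose n + y) := fun n => by
    rw [puncturedCrandall, if_neg]
    exact fun h => ne_neg_of_notMem_reciprocalLattice hy n (eq_neg_of_add_eq_zero_left h)
  rw [tsum_upperCrandall_eq hA] at h
  rw [epsteinEntire, crandallSeries]
  simp_rw [hq]
  have hite : (if x ∈ epsteinLattice A then (Complex.Gamma (ν / 2 + 1))⁻¹ else 0) =
      -(if x ∈ epsteinLattice A then -2 / ν else 0) * (Complex.Gamma (ν / 2))⁻¹ := by
    split_ifs
    · rw [← one_div_two_mul_Gamma_inv hne]; ring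
    · ring
  rw [hite, neg_mul, sub_neg_eq_add, ← add_mul, add_right_comm, ← h, mul_assoc (Complex.Gamma _),
    mul_comm (Complex.Gamma _), mul_assoc, mul_inv_cancel₀ hG, mul_one, ← mul_assoc, hpi, one_mul]

theorem hasSum_epsteinLattice_diff_iff {d : ℕ} {A : Matrix (Fin d) (Fin d) ℝ} (hA : A.det ≠ 0)
    (x : EuclideanSpace ℝ (Fin d)) (f : EuclideanSpace ℝ (Fin d) → ℂ) (a : ℂ) :
    HasSum (fun z : ↥(epsteinLattice A \ {x}) => f z) a ↔
      HasSum (fun n : Fin d → ℤ => if latticePoint A n - x = 0 then 0 else f (latticePoint A n))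
        a := by
  have h1 : HasSum (fun z : ↥(epsteinLattice A \ {x}) => f z) a ↔
      HasSum ((epsteinLattice A \ {x}).indicator f) a := hasSum_subtype_iff_indicator
  rw [h1, ← (latticePoint_injective hA).hasSum_iff]
  · have : (epsteinLattice A \ {x}).indicator f ∘ latticePoint A = fun n : Fin d → ℤ =>
        if latticePoint A n - x = 0 then 0 else f (latticePoint A n) := by
      ext n
      rw [Function.comp_apply]
      split_ifs with h
      · exact indicator_of_notMem (fun h' => h'.2 (sub_eq_zero.1 h)) f
      · exact indicator_of_mem (s := epsteinLattice A \ {x}) ⟨⟨n, rfl⟩, fun h' => h (sub_eq_zero.2 h')⟩ f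
    rw [this]
  · exact fun z hz => indicator_of_notMem (fun h => hz h.1) f

/-- **Identity theorem** for a meromorphic function in normal form and an entire function. -/
theorem MeromorphicNFOn.eq_of_eventuallyEq_differentiable {f g : ℂ → ℂ}
    (hf : MeromorphicNFOn f univ) (hg : Differentiable ℂ g) {z₀ : ℂ} (h : f =ᶠ[𝓝 z₀] g) :
    f = g := by
  have hg' : ∀ z, AnalyticAt ℂ g z := fun z => hg.analyticAt z
  have hm : MeromorphicOn (f - g) univ := fun z hz =>
    (hf hz).meromorphicAt.sub (hg' z).meromorphicAt
  have h0 : meromorphicOrderAt (f - g) z₀ = ⊤ := by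
    rw [meromorphicOrderAt_eq_top_iff]
    refine Filter.Eventually.filter_mono nhdsWithin_le_nhds ?_
    filter_upwards [h] with z hz
    simp [hz]
  ext z
  -- On the connected plane the order of a meromorphic function is infinite either everywhere or
  -- nowhere. This gives equality on punctured neighbourhoods; the normal form of `f` extends it to
  -- the centre.
  have hz : meromorphicOrderAt (f - g) z = ⊤ := by
    by_contra hne
    exact (hm.exists_meromorphicOrderAt_ne_top_iff_forall isConnected_univ).1
      ⟨⟨z, mem_univ z⟩, hne⟩ ⟨z₀, mem_univ z₀⟩ h0
  rw [meromorphicOrderAt_eq_top_iff] at hz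
  have hz' : f =ᶠ[𝓝[≠] z] g := by
    filter_upwards [hz] with w hw
    simpa [sub_eq_zero] using hw
  exact (((hf (mem_univ z)).eventuallyEq_nhdsNE_iff_eventuallyEq_nhds
    (hg' z).meromorphicNFAt).1 hz').eq_of_nhds

theorem exists_eventually_lt_re (d : ℕ) : ∃ z₀ : ℂ, ∀ᶠ ν in 𝓝 z₀, (d : ℝ) < ν.re :=
  ⟨((d + 1 : ℝ) : ℂ), (isOpen_lt continuous_const Complex.continuous_re).mem_nhds (by simp)⟩

theorem epsteinTerm_mul_planeWave {d : ℕ} {x y z : EuclideanSpace ℝ (Fin d)} (ν : ℂ) :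
    planeWave y x * epsteinTerm ν y (z - x) =
      if z - x = 0 then 0 else
        Complex.exp (-(2 * Real.pi * Complex.I * (inner ℝ y z : ℝ))) /
          ((‖x - z‖ : ℝ) : ℂ) ^ ν := by
  rw [epsteinTerm]
  split_ifs with h
  · rw [mul_zero]
  · rw [planeWave_sub_right, ← planeWave, Complex.cpow_neg, norm_sub_rev]
    linear_combination (((‖x - z‖ : ℝ) : ℂ) ^ ν)⁻¹ * planeWave y z * planeWave_mul_planeWave_neg y x

/-- For `y` off the reciprocal lattice no reciprocal summand sits at the origin, so nothing produces
a pole at `ν = d` and the continuation is even entire. The plane wave restores the phase `exp(-2πi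
y·x)`. -/
theorem isEpsteinContinuation_epsteinEntire {d : ℕ} {A : Matrix (Fin d) (Fin d) ℝ}
    (hA : A.det ≠ 0) (x : EuclideanSpace ℝ (Fin d)) {y : EuclideanSpace ℝ (Fin d)}
    (hy : y ∉ reciprocalLattice A) :
    IsEpsteinContinuation A x y fun ν => planeWave y x * epsteinEntire A x y ν := by
  refine ⟨fun ν _ => (((differentiable_epsteinEntire hA x y).const_mul
    (planeWave y x)).analyticAt ν).meromorphicNFAt, fun ν hν => ?_⟩
  rw [hasSum_epsteinLattice_diff_iff hA x (fun z =>
    Complex.exp (-(2 * Real.pi * Complex.I * (inner ℝ y z : ℝ))) / ((‖x - z‖ : ℝ) : ℂ) ^ ν)]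
  simp only [← epsteinTerm_mul_planeWave]
  rw [epsteinEntire_eq_tsum hA x hy hν]
  exact (summable_epsteinTerm hA x y hν).hasSum.mul_left _

theorem isEpsteinContinuation_epsteinZeta {d : ℕ} {A : Matrix (Fin d) (Fin d) ℝ}
    (hA : A.det ≠ 0) (x : EuclideanSpace ℝ (Fin d)) {y : EuclideanSpace ℝ (Fin d)}
    (hy : y ∉ reciprocalLattice A) :
    IsEpsteinContinuation A x y fun ν => epsteinZeta A ν x y := by
  have h : ∃ f : ℂ → ℂ, IsEpsteinContinuation A x y f :=
    ⟨_, isEpsteinContinuation_epsteinEntire hA x hy⟩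
  have : (fun ν => epsteinZeta A ν x y) = h.choose := by
    ext ν
    rw [epsteinZeta, dif_pos h]
  rw [this]
  exact h.choose_spec

/-- `epsteinZeta` is an arbitrary choice among continuations, but the normal form condition and the
identity theorem leave only one. -/
theorem epsteinZeta_eq {d : ℕ} {A : Matrix (Fin d) (Fin d) ℝ} (hA : A.det ≠ 0)
    (x : EuclideanSpace ℝ (Fin d)) {y : EuclideanSpace ℝ (Fin d)}
    (hy : y ∉ reciprocalLattice A) (ν : ℂ) :
    epsteinZeta A ν x y = planeWave y x * epsteinEntire A x y ν := by
  have h1 := isEpsteinContinuation_epsteinZeta hA x hy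
  have h2 := isEpsteinContinuation_epsteinEntire hA x hy
  obtain ⟨z₀, hz₀⟩ := exists_eventually_lt_re d
  refine congrFun (h1.1.eq_of_eventuallyEq_differentiable
    ((differentiable_epsteinEntire hA x y).const_mul (planeWave y x)) (z₀ := z₀) ?_) ν
  filter_upwards [hz₀] with μ hμ
  exact (h1.2 μ hμ).unique (h2.2 μ hμ)

/-! ### The cutoff parameter by scaling the lattice -/

theorem det_smul_ne_zero {d : ℕ} {A : Matrix (Fin d) (Fin d) ℝ} (hA : A.det ≠ 0) {c : ℝ}
    (hc : c ≠ 0) : (c • A).det ≠ 0 := by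
  rw [Matrix.det_smul]
  exact mul_ne_zero (pow_ne_zero _ hc) hA

theorem inv_smul_transpose {d : ℕ} {A : Matrix (Fin d) (Fin d) ℝ} (hA : A.det ≠ 0) {c : ℝ}
    (hc : c ≠ 0) : (c⁻¹ • A)⁻¹.transpose = c • A⁻¹.transpose := by
  rw [← Matrix.transpose_smul]
  congr 1
  refine Matrix.inv_eq_right_inv ?_
  rw [Matrix.smul_mul, Matrix.mul_smul, smul_smul, inv_mul_cancel₀ hc, one_smul,
    Matrix.mul_nonsing_inv A (isUnit_iff_ne_zero.2 hA)]

theorem cellVolume_smul {d : ℕ} (A : Matrix (Fin d) (Fin d) ℝ) {c : ℝ} (hc : 0 < c) :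
    (cellVolume (c⁻¹ • A))⁻¹ = c ^ d / cellVolume A := by
  rw [cellVolume, Matrix.det_smul, abs_mul, Fintype.card_fin, abs_of_pos (by positivity),
    cellVolume, mul_inv, inv_pow, inv_inv, div_eq_mul_inv]

theorem smul_mem_epsteinLattice_smul {d : ℕ} (A : Matrix (Fin d) (Fin d) ℝ) {c : ℝ} (hc : c ≠ 0)
    (x : EuclideanSpace ℝ (Fin d)) :
    c • x ∈ epsteinLattice (c • A) ↔ x ∈ epsteinLattice A := by
  simp only [epsteinLattice_eq_range, mem_range, latticePoint_smul]
  refine exists_congr fun n => ?_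
  exact (smul_right_injective _ hc).eq_iff

theorem planeWave_smul_smul_inv {d : ℕ} {c : ℝ} (hc : c ≠ 0) (y z : EuclideanSpace ℝ (Fin d)) :
    planeWave (c • y) (c⁻¹ • z) = planeWave y z := by
  rw [planeWave, planeWave, inner_smul_left, inner_smul_right, ← mul_assoc]
  simp [hc]

theorem epsteinTerm_smul {d : ℕ} {c : ℝ} (hc : 0 < c) (ν : ℂ) (y z : EuclideanSpace ℝ (Fin d)) :
    epsteinTerm ν (c • y) (c⁻¹ • z) = (c : ℂ) ^ ν * epsteinTerm ν y z := by
  rw [epsteinTerm, epsteinTerm, planeWave_smul_smul_inv hc.ne']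
  by_cases hz : z = 0
  · simp [hz]
  · have hz' : c⁻¹ • z ≠ 0 := smul_ne_zero (inv_ne_zero hc.ne') hz
    have hzn : 0 < ‖z‖ := norm_pos_iff.2 hz
    rw [if_neg hz, if_neg hz', norm_smul, Real.norm_of_nonneg (inv_pos.2 hc).le,
      ofReal_cpow_eq_exp (by positivity), ofReal_cpow_eq_exp hzn, ofReal_cpow_eq_exp hc,
      ← mul_assoc, ← Complex.exp_add, Real.log_mul (by positivity) hzn.ne', Real.log_inv]
    congr 2
    push_cast
    ring

/-- The Crandall representation with cutoff parameter `c`, obtained by scaling the lattice. -/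
theorem epsteinEntire_smul {d : ℕ} {A : Matrix (Fin d) (Fin d) ℝ} (hA : A.det ≠ 0)
    (x : EuclideanSpace ℝ (Fin d)) {y : EuclideanSpace ℝ (Fin d)}
    (hy : y ∉ reciprocalLattice A) {c : ℝ} (hc : 0 < c) (ν : ℂ) :
    epsteinEntire (c⁻¹ • A) (c⁻¹ • x) (c • y) ν = (c : ℂ) ^ ν * epsteinEntire A x y ν := by
  have hc0 : (c : ℂ) ≠ 0 := by exact_mod_cast hc.ne'
  have hA' := det_smul_ne_zero hA (inv_ne_zero hc.ne')
  have hy' : c • y ∉ reciprocalLattice (c⁻¹ • A) := by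
    rw [reciprocalLattice, inv_smul_transpose hA hc.ne', smul_mem_epsteinLattice_smul _ hc.ne']
    exact hy
  obtain ⟨z₀, hz₀⟩ := exists_eventually_lt_re d
  have h1 : AnalyticOnNhd ℂ (epsteinEntire (c⁻¹ • A) (c⁻¹ • x) (c • y)) univ := fun z _ =>
    (differentiable_epsteinEntire hA' _ _).analyticAt z
  have h2 : AnalyticOnNhd ℂ (fun ν => (c : ℂ) ^ ν * epsteinEntire A x y ν) univ := fun z _ =>
    ((differentiable_id.const_cpow (Or.inl hc0)).mul
      (differentiable_epsteinEntire hA x y)).analyticAt z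
  -- Both sides are entire, so it is enough to compare the Dirichlet series term by term where they
  -- converge.
  refine congrFun (h1.eq_of_eventuallyEq h2 (z₀ := z₀) ?_) ν
  filter_upwards [hz₀] with μ hμ
  rw [epsteinEntire_eq_tsum hA' _ hy' hμ, epsteinEntire_eq_tsum hA _ hy hμ, ← tsum_mul_left]
  refine tsum_congr fun n => ?_
  rw [latticePoint_smul, ← smul_sub, epsteinTerm_smul hc]

/-! ### Closed forms of the regularised Crandall function -/

/-- The limiting branch at the poles and the ordinary branch agree once `Γ((d - ν)/2)` is cancelled.
Since `ν` is not in `-2ℕ₀`, `d - ν` never meets the logarithmic exponents. -/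
theorem gammaMulPowerFourier_of_generic {d : ℕ} {ν : ℂ} (hν : ¬ ∃ k : ℕ, ν = -(2 * k))
    (y : EuclideanSpace ℝ (Fin d)) :
    gammaMulPowerFourier d (d - ν) y = (Real.pi : ℂ) ^ ((d - ν) / 2) * Complex.Gamma (ν / 2) *
      ((Real.pi * ‖y‖ ^ 2 : ℝ) : ℂ) ^ (-(ν / 2)) := by
  have e1 : ((d : ℂ) - (d - ν)) / 2 = ν / 2 := by ring
  have e2 : ((d : ℂ) - ν - d) / 2 = -(ν / 2) := by ring
  rw [gammaMulPowerFourier]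
  split_ifs with h
  · rw [e1, e2]
  · have h' : ¬ ∃ k : ℕ, (d : ℂ) - ν = d + 2 * k := by
      rintro ⟨k, hk⟩
      exact hν ⟨k, by linear_combination -hk⟩
    have hG : Complex.Gamma (((d : ℂ) - ν) / 2) ≠ 0 :=
      Complex.Gamma_ne_zero fun m hm => h ⟨m, by linear_combination 2 * hm⟩
    rw [powerFourier, dif_neg h', e1, e2]
    field_simp

theorem powerFourier_add_two_mul (d k : ℕ) (y : EuclideanSpace ℝ (Fin d)) :
    powerFourier d (d + 2 * k) y =
      (Real.pi : ℂ) ^ ((k : ℂ) + d / 2) / Complex.Gamma ((k : ℂ) + d / 2)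
      * ((-1) ^ (k + 1) / (k.factorial : ℂ))
      * (((Real.pi * ‖y‖ ^ 2) ^ k * Real.log (Real.pi * ‖y‖ ^ 2) : ℝ) : ℂ) := by
  have h : ∃ m : ℕ, (d + 2 * k : ℂ) = d + 2 * m := ⟨k, rfl⟩
  have hk : h.choose = k := by
    have h1 := h.choose_spec
    have h2 : ((h.choose : ℕ) : ℂ) = k := by linear_combination -h1 / 2
    exact_mod_cast h2
  rw [powerFourier, dif_pos h, hk]

theorem pi_mul_norm_smul_sq {d : ℕ} (c : ℝ) (y : EuclideanSpace ℝ (Fin d)) :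
    Real.pi * ‖c • y‖ ^ 2 = Real.pi * c ^ 2 * ‖y‖ ^ 2 := by
  rw [norm_smul, mul_pow, Real.norm_eq_abs, sq_abs, mul_assoc]

/-- With `X = π λ² |y|²` the subtracted term is exactly `Γ(ν/2) X^(-ν/2)`, the nonanalytic part of
`G_ν(λ y)`; what is left is the Tricomi term. -/
theorem upperCrandallRegAux_of_generic {d : ℕ} {ν : ℂ} (hν : ¬ ∃ k : ℕ, ν = -(2 * k)) {c : ℝ}
    (hc : 0 < c) {y : EuclideanSpace ℝ (Fin d)} (hy : y ≠ 0) :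
    upperCrandallRegAux ν c y = -lowerCrandall ν (c • y) := by
  have hyn : 0 < ‖y‖ := norm_pos_iff.2 hy
  have hX : 0 < Real.pi * c ^ 2 * ‖y‖ ^ 2 := by positivity
  have hν' : ∀ m : ℕ, ν / 2 ≠ -m := fun m hm => hν ⟨m, by linear_combination 2 * hm⟩
  have hpow : (c : ℂ) ^ (-ν) * (Real.pi : ℂ) ^ (-(d - ν) / 2) *
      ((Real.pi : ℂ) ^ ((d - ν) / 2) * Complex.Gamma (ν / 2) *
      ((Real.pi * ‖y‖ ^ 2 : ℝ) : ℂ) ^ (-(ν / 2))) = Complex.Gamma (ν / 2) *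
        ((Real.pi * c ^ 2 * ‖y‖ ^ 2 : ℝ) : ℂ) ^ (-(ν / 2)) := by
    have h1 : (c : ℂ) ^ (-ν) * ((Real.pi * ‖y‖ ^ 2 : ℝ) : ℂ) ^ (-(ν / 2)) =
        ((Real.pi * c ^ 2 * ‖y‖ ^ 2 : ℝ) : ℂ) ^ (-(ν / 2)) := by
      rw [ofReal_cpow_eq_exp hc, ofReal_cpow_eq_exp (by positivity), ofReal_cpow_eq_exp hX,
        ← Complex.exp_add, mul_right_comm Real.pi,
        Real.log_mul (x := Real.pi * ‖y‖ ^ 2) (by positivity) (by positivity), Real.log_pow]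
      congr 1
      push_cast
      ring
    have h2 : (Real.pi : ℂ) ^ (-(d - ν) / 2) * (Real.pi : ℂ) ^ ((d - ν) / 2) = 1 := by
      rw [← Complex.cpow_add _ _ (by exact_mod_cast Real.pi_ne_zero), neg_div, neg_add_cancel,
        Complex.cpow_zero]
    rw [← h1]
    linear_combination (c : ℂ) ^ (-ν) * Complex.Gamma (ν / 2) *
      ((Real.pi * ‖y‖ ^ 2 : ℝ) : ℂ) ^ (-(ν / 2)) * h2
  rw [upperCrandallRegAux, gammaMulPowerFourier_of_generic hν, hpow,
    upperCrandall_of_ne ν (smul_ne_zero hc.ne' hy), lowerCrandall, pi_mul_norm_smul_sq,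
    expIntegral_eq_sub_tricomiGammaStar hν' hX]
  ring

theorem upperCrandallRegAux_of_exceptional {d : ℕ} (hd : 0 < d) (k : ℕ) {c : ℝ}
    (hc : 0 < c) {y : EuclideanSpace ℝ (Fin d)} (hy : y ≠ 0) :
    upperCrandallRegAux (-(2 * k)) c y = (((-1) ^ k / (k.factorial : ℝ)
      * ((harmonic k : ℝ) - Real.eulerMascheroniConstant - Real.log (c ^ 2))
      * (Real.pi * c ^ 2 * ‖y‖ ^ 2) ^ k
      - ∑' n, poleSeriesTerm k (Real.pi * c ^ 2 * ‖y‖ ^ 2) n : ℝ) : ℂ) := by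
  have hyn : 0 < ‖y‖ := norm_pos_iff.2 hy
  have hX : 0 < Real.pi * c ^ 2 * ‖y‖ ^ 2 := by positivity
  -- As `d > 0`, the exponent `d + 2k` avoids `-2ℕ₀`, so the gamma factors are nonzero and cancel.
  have hne : ¬ ∃ m : ℕ, ((d : ℂ) - -(2 * k)) = -(2 * m) := by
    rintro ⟨m, hm⟩
    have : ((d + 2 * k + 2 * m : ℕ) : ℂ) = 0 := by push_cast; linear_combination hm
    have := Nat.cast_eq_zero.1 this
    omega
  have e1 : ((d : ℂ) - -(2 * k)) / 2 = k + d / 2 := by ring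
  have hG : Complex.Gamma ((k : ℂ) + d / 2) ≠ 0 := by
    rw [← e1]
    exact Complex.Gamma_ne_zero fun m hm => hne ⟨m, by linear_combination 2 * hm⟩
  -- The logarithmic choice of `ŝ_{d+2k}` removes `log(π |y|²)`; the constant `log λ²` stays in the
  -- result.
  have hlog : Real.log (Real.pi * c ^ 2 * ‖y‖ ^ 2) =
      Real.log (c ^ 2) + Real.log (Real.pi * ‖y‖ ^ 2) := by
    rw [← Real.log_mul (by positivity) (by positivity)]
    congr 1
    ring
  have hpi : (Real.pi : ℂ) ^ (-(k + d / 2 : ℂ)) * (Real.pi : ℂ) ^ ((k : ℂ) + d / 2) = 1 := by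
    rw [← Complex.cpow_add _ _ (by exact_mod_cast Real.pi_ne_zero), neg_add_cancel,
      Complex.cpow_zero]
  have hck : (c : ℂ) ^ (-(-(2 * k)) : ℂ) = (c : ℂ) ^ (2 * k) := by
    rw [neg_neg]
    exact_mod_cast Complex.cpow_natCast (c : ℂ) (2 * k)
  rw [upperCrandallRegAux, gammaMulPowerFourier, if_neg hne,
    upperCrandall_of_ne _ (smul_ne_zero hc.ne' hy), pi_mul_norm_smul_sq,
    show (-(2 * k) : ℂ) / 2 = -k by ring, expIntegral_neg_natCast k hX, e1,
    show (d : ℂ) - -(2 * k) = d + 2 * k by ring, powerFourier_add_two_mul, hck, hlog,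
    show -((d : ℂ) + 2 * k) / 2 = -(k + d / 2) by ring]
  have h3 : (c : ℂ) ^ (2 * k) * (Real.pi : ℂ) ^ (-(k + d / 2 : ℂ)) *
      (Complex.Gamma ((k : ℂ) + d / 2) * ((Real.pi : ℂ) ^ ((k : ℂ) + d / 2) /
        Complex.Gamma ((k : ℂ) + d / 2)
      * ((-1) ^ (k + 1) / (k.factorial : ℂ))
      * (((Real.pi * ‖y‖ ^ 2) ^ k * Real.log (Real.pi * ‖y‖ ^ 2) : ℝ) : ℂ))) =
      ((c ^ (2 * k) * ((-1) ^ (k + 1) / (k.factorial : ℝ)) *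
        ((Real.pi * ‖y‖ ^ 2) ^ k * Real.log (Real.pi * ‖y‖ ^ 2)) : ℝ) : ℂ) := by
    generalize (k : ℂ) + d / 2 = σ at hG hpi ⊢
    have hG' : Complex.Gamma σ * (Complex.Gamma σ)⁻¹ = 1 := mul_inv_cancel₀ hG
    rw [div_eq_mul_inv, Complex.ofReal_mul, Complex.ofReal_mul]
    push_cast
    linear_combination (c : ℂ) ^ (2 * k) * ((-1) ^ (k + 1) / (k.factorial : ℂ)) *
      ((Real.pi * ‖y‖ ^ 2) ^ k * Real.log (Real.pi * ‖y‖ ^ 2)) *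
      ((Real.pi : ℂ) ^ (-σ) * (Real.pi : ℂ) ^ σ * hG' + hpi)
  rw [h3, ← Complex.ofReal_sub]
  congr 1
  ring

theorem tendsto_and_eq_of_continuous {X : Type*} [TopologicalSpace X] {a : X} [(𝓝[≠] a).NeBot]
    {f g : X → ℂ} (hg : Continuous g) (h : ∀ x, x ≠ a → f x = g x) :
    Tendsto f (𝓝[≠] a) (𝓝 (g a)) ∧ limUnder (𝓝[≠] a) f = g a := by
  have h1 : Tendsto f (𝓝[≠] a) (𝓝 (g a)) := by
    refine ((hg.tendsto a).mono_left nhdsWithin_le_nhds).congr' ?_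
    filter_upwards [self_mem_nhdsWithin] with x hx
    exact (h x hx).symm
  exact ⟨h1, h1.limUnder_eq⟩

/-- In positive dimension the origin is not isolated, so the limits defining the values at `y = 0`
are unique. -/
theorem neBot_nhdsNE_zero {d : ℕ} (hd : 0 < d) : (𝓝[≠] (0 : EuclideanSpace ℝ (Fin d))).NeBot := by
  have : Nonempty (Fin d) := ⟨⟨0, hd⟩⟩
  infer_instance

/-- The regularised upper Crandall function is the continuous extension of its restriction to
`y ≠ 0`. -/
theorem upperCrandallReg_eq_of_continuous {d : ℕ} (hd : 0 < d) {ν : ℂ} {c : ℝ}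
    {g : EuclideanSpace ℝ (Fin d) → ℂ} (hg : Continuous g)
    (h : ∀ y, y ≠ 0 → upperCrandallRegAux ν c y = g y) (y : EuclideanSpace ℝ (Fin d)) :
    upperCrandallReg ν c y = g y := by
  have := neBot_nhdsNE_zero hd
  rw [upperCrandallReg]
  split_ifs with hy
  · rw [(tendsto_and_eq_of_continuous hg h).2, hy]
  · exact h y hy

theorem upperCrandallReg_of_generic {d : ℕ} (hd : 0 < d) {ν : ℂ} (hν : ¬ ∃ k : ℕ, ν = -(2 * k))
    {c : ℝ} (hc : 0 < c) (y : EuclideanSpace ℝ (Fin d)) :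
    upperCrandallReg ν c y = -lowerCrandall ν (c • y) := by
  refine upperCrandallReg_eq_of_continuous hd (g := fun y => -lowerCrandall ν (c • y)) ?_
    (fun y hy => upperCrandallRegAux_of_generic hν hc hy) y
  have := continuous_tricomiGammaStar (ν / 2)
  unfold lowerCrandall
  fun_prop

theorem upperCrandallReg_of_exceptional {d : ℕ} (hd : 0 < d) (k : ℕ) {c : ℝ} (hc : 0 < c)
    (y : EuclideanSpace ℝ (Fin d)) :
    upperCrandallReg (-(2 * k)) c y = (((-1) ^ k / (k.factorial : ℝ)
      * ((harmonic k : ℝ) - Real.eulerMascheroniConstant - Real.log (c ^ 2))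
      * (Real.pi * c ^ 2 * ‖y‖ ^ 2) ^ k
      - ∑' n, poleSeriesTerm k (Real.pi * c ^ 2 * ‖y‖ ^ 2) n : ℝ) : ℂ) := by
  refine upperCrandallReg_eq_of_continuous hd (g := fun y => (((-1) ^ k / (k.factorial : ℝ)
      * ((harmonic k : ℝ) - Real.eulerMascheroniConstant - Real.log (c ^ 2))
      * (Real.pi * c ^ 2 * ‖y‖ ^ 2) ^ k
      - ∑' n, poleSeriesTerm k (Real.pi * c ^ 2 * ‖y‖ ^ 2) n : ℝ) : ℂ)) ?_
    (fun y hy => upperCrandallRegAux_of_exceptional hd k hc hy) y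
  have h : Continuous fun y : EuclideanSpace ℝ (Fin d) =>
      ∑' n, poleSeriesTerm k (Real.pi * c ^ 2 * ‖y‖ ^ 2) n :=
    (continuous_tsum_poleSeriesTerm k).comp (by fun_prop)
  fun_prop

theorem continuous_upperCrandallReg {d : ℕ} (hd : 0 < d) (ν : ℂ) {c : ℝ} (hc : 0 < c) :
    Continuous (upperCrandallReg (d := d) ν c) := by
  by_cases hν : ∃ k : ℕ, ν = -(2 * k)
  · obtain ⟨k, rfl⟩ := hν
    rw [funext (upperCrandallReg_of_exceptional hd k hc)]
    have h : Continuous fun y : EuclideanSpace ℝ (Fin d) =>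
        ∑' n, poleSeriesTerm k (Real.pi * c ^ 2 * ‖y‖ ^ 2) n :=
      (continuous_tsum_poleSeriesTerm k).comp (by fun_prop)
    fun_prop
  · rw [funext (upperCrandallReg_of_generic hd hν hc)]
    have := continuous_tricomiGammaStar (ν / 2)
    unfold lowerCrandall
    fun_prop

theorem upperCrandallReg_of_ne {d : ℕ} (ν : ℂ) (c : ℝ) {y : EuclideanSpace ℝ (Fin d)}
    (hy : y ≠ 0) : upperCrandallReg ν c y = upperCrandallRegAux ν c y := by
  rw [upperCrandallReg, if_neg hy]

theorem tendsto_upperCrandallRegAux {d : ℕ} (hd : 0 < d) (ν : ℂ) {c : ℝ} (hc : 0 < c) :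
    Tendsto (upperCrandallRegAux (d := d) ν c) (𝓝[≠] 0) (𝓝 (upperCrandallReg (d := d) ν c 0)) := by
  have := neBot_nhdsNE_zero hd
  exact (tendsto_and_eq_of_continuous (continuous_upperCrandallReg hd ν hc)
    fun y hy => (upperCrandallReg_of_ne ν c hy).symm).1

/-! ### Continuity of the Crandall series at `y = 0` -/

theorem zero_mem_reciprocalLattice {d : ℕ} (A : Matrix (Fin d) (Fin d) ℝ) :
    0 ∈ reciprocalLattice A := ⟨0, latticePoint_zero _⟩

theorem summable_norm_upperCrandall_smul {d : ℕ} {A : Matrix (Fin d) (Fin d) ℝ}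
    (hA : A.det ≠ 0) (x : EuclideanSpace ℝ (Fin d)) {c : ℝ} (hc : c ≠ 0) (ν : ℂ) :
    Summable fun n : Fin d → ℤ => ‖upperCrandall ν (c • (latticePoint A n - x))‖ := by
  simp_rw [smul_sub, ← latticePoint_smul]
  exact summable_norm_upperCrandall (det_smul_ne_zero hA hc) _ ν

theorem continuousAt_upperCrandall {d : ℕ} (ν : ℂ) {z : EuclideanSpace ℝ (Fin d)} (hz : z ≠ 0) :
    ContinuousAt (upperCrandall ν) z := by
  have h0 : 0 < Real.pi * ‖z‖ ^ 2 := by positivity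
  have h1 : ContinuousAt (fun w : EuclideanSpace ℝ (Fin d) =>
      expIntegral (ν / 2) (Real.pi * ‖w‖ ^ 2)) z :=
    ContinuousAt.comp (f := fun w : EuclideanSpace ℝ (Fin d) => Real.pi * ‖w‖ ^ 2)
      ((continuousOn_expIntegral (ν / 2)).continuousAt (Ioi_mem_nhds h0)) (by fun_prop)
  refine h1.congr ?_
  filter_upwards [isOpen_ne.mem_nhds hz] with w hw
  exact (upperCrandall_of_ne ν hw).symm

/-- The real-space part of Crandall's representation. -/
def directSeries {d : ℕ} (A : Matrix (Fin d) (Fin d) ℝ) (ν : ℂ) (c : ℝ)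
    (x y : EuclideanSpace ℝ (Fin d)) : ℂ :=
  ∑' n : Fin d → ℤ,
    puncturedCrandall ν (c⁻¹ • (latticePoint A n - x)) * planeWave y (latticePoint A n - x)

/-- The reciprocal part of Crandall's representation, without the summand at the origin. -/
def reciprocalSeries {d : ℕ} (A : Matrix (Fin d) (Fin d) ℝ) (ν : ℂ) (c : ℝ)
    (x y : EuclideanSpace ℝ (Fin d)) : ℂ :=
  ∑' n : Fin d → ℤ, if n = 0 then 0 else
    upperCrandall ν (c • (latticePoint A⁻¹.transpose n + y)) *
      planeWave x (latticePoint A⁻¹.transpose n)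

theorem norm_puncturedCrandall_le {d : ℕ} (ν : ℂ) (z : EuclideanSpace ℝ (Fin d)) :
    ‖puncturedCrandall ν z‖ ≤ ‖upperCrandall ν z‖ := by
  rw [puncturedCrandall]
  split_ifs <;> simp

theorem continuous_directSeries {d : ℕ} {A : Matrix (Fin d) (Fin d) ℝ} (hA : A.det ≠ 0) (ν : ℂ)
    {c : ℝ} (hc : c ≠ 0) (x : EuclideanSpace ℝ (Fin d)) :
    Continuous (directSeries A ν c x) := by
  refine continuous_tsum (fun n => continuous_const.mul (continuous_planeWave_left _))
    (summable_norm_upperCrandall_smul hA x (inv_ne_zero hc) ν) fun n y => ?_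
  rw [norm_mul, norm_planeWave, mul_one]
  exact norm_puncturedCrandall_le _ _

/-- Nonzero reciprocal points have norm at least some `δ`. For `|y| < δ/2` this gives `|k + y| ≥
|k|/2`, hence a Gaussian majorant in `k` uniform in `y`. -/
theorem continuousAt_reciprocalSeries {d : ℕ} {A : Matrix (Fin d) (Fin d) ℝ} (hA : A.det ≠ 0)
    (ν : ℂ) {c : ℝ} (hc : 0 < c) (x : EuclideanSpace ℝ (Fin d)) :
    ContinuousAt (reciprocalSeries A ν c x) 0 := by
  have hB := det_inv_transpose_ne_zero hA
  obtain ⟨δ, hδ, hle⟩ := exists_le_norm_latticePoint_sub hB 0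
  simp only [sub_zero] at hle
  have hpt : ∀ n, n ≠ 0 → latticePoint A⁻¹.transpose n ≠ 0 := fun n hn h =>
    hn (latticePoint_injective hB (h.trans (latticePoint_zero _).symm))
  obtain ⟨C, hC0, hC⟩ := exists_norm_upperCrandall_le ν.re
    (δ := c * (δ / 2)) (by positivity)
  have hball : ∀ n, n ≠ 0 → ∀ y ∈ Metric.ball (0 : EuclideanSpace ℝ (Fin d)) (δ / 2),
      ‖latticePoint A⁻¹.transpose n‖ / 2 ≤ ‖latticePoint A⁻¹.transpose n + y‖ := fun n hn y hy => by
    have h1 := hle n (hpt n hn)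
    have h2 := mem_ball_zero_iff.1 hy
    have h3 := norm_sub_le_norm_add (latticePoint A⁻¹.transpose n) y
    linarith
  refine ContinuousOn.continuousAt (s := Metric.ball 0 (δ / 2)) ?_
    (Metric.ball_mem_nhds _ (by positivity))
  refine continuousOn_tsum (u := fun n => C * Real.exp
    (-(Real.pi / 2 * (c / 2) ^ 2 * ‖latticePoint A⁻¹.transpose n - 0‖ ^ 2))) (fun n => ?_)
    ((summable_exp_neg_norm_sq hB 0 (by positivity)).mul_left C) fun n y hy => ?_
  · by_cases hn : n = 0
    · simp only [hn, if_true]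
      exact continuousOn_const
    · simp only [hn, if_false]
      refine ContinuousOn.mul (fun y hy => ?_) continuousOn_const
      have h0 : 0 < ‖latticePoint A⁻¹.transpose n + y‖ :=
        (half_pos (norm_pos_iff.2 (hpt n hn))).trans_le (hball n hn y hy)
      have h1 : c • (latticePoint A⁻¹.transpose n + y) ≠ 0 :=
        smul_ne_zero hc.ne' (norm_pos_iff.1 h0)
      exact (ContinuousAt.comp (f := fun y => c • (latticePoint A⁻¹.transpose n + y))
        (continuousAt_upperCrandall ν h1) (by fun_prop)).continuousWithinAt
  · split_ifs with hn
    · rw [norm_zero]; positivity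
    · have h1 := hball n hn y hy
      have h2 := hle n (hpt n hn)
      rw [norm_mul, norm_planeWave, mul_one, sub_zero]
      have h3 : ‖c • (latticePoint A⁻¹.transpose n + y)‖ =
          c * ‖latticePoint A⁻¹.transpose n + y‖ := by
        rw [norm_smul, Real.norm_of_nonneg hc.le]
      refine (hC ν le_rfl d _ ?_).trans ?_
      · rw [h3]
        gcongr
        linarith
      · rw [h3]
        refine mul_le_mul_of_nonneg_left (Real.exp_le_exp.2 (neg_le_neg ?_)) hC0
        have h4 := mul_le_mul_of_nonneg_left h1 hc.le
        have h5 := pow_le_pow_left₀ (by positivity) h4 2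
        have h6 := mul_le_mul_of_nonneg_left h5 (by positivity : 0 ≤ Real.pi / 2)
        refine le_trans (le_of_eq ?_) h6
        ring

/-! ### The representation of the regularised zeta function -/

open Classical in
/-- The right-hand side of Crandall's representation of the regularised Epstein zeta function, with
the summand at `z = x` expressed by `G_ν(0) / Γ(ν/2) = -1 / Γ(ν/2 + 1)`. -/
def crandallRegSeries {d : ℕ} (A : Matrix (Fin d) (Fin d) ℝ) (ν : ℂ) (c : ℝ)
    (x y : EuclideanSpace ℝ (Fin d)) : ℂ :=
  ((c ^ 2 / Real.pi : ℝ) : ℂ) ^ (-ν / 2) *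
    ((directSeries A ν c x y + (c : ℂ) ^ d / (cellVolume A : ℂ) *
      (upperCrandallReg (d - ν) c y + reciprocalSeries A (d - ν) c x y)) *
        (Complex.Gamma (ν / 2))⁻¹ -
      if x ∈ epsteinLattice A then (Complex.Gamma (ν / 2 + 1))⁻¹ else 0)

theorem continuousAt_crandallRegSeries {d : ℕ} (hd : 0 < d) {A : Matrix (Fin d) (Fin d) ℝ}
    (hA : A.det ≠ 0) (ν : ℂ) {c : ℝ} (hc : 0 < c) (x : EuclideanSpace ℝ (Fin d)) :
    ContinuousAt (crandallRegSeries A ν c x) 0 := by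
  have h1 := (continuous_directSeries hA ν hc.ne' x).continuousAt (x := 0)
  have h2 := continuousAt_reciprocalSeries hA (d - ν) hc x
  have h3 := (continuous_upperCrandallReg hd (d - ν) hc).continuousAt (x := 0)
  exact continuousAt_const.mul (((h1.add (continuousAt_const.mul (h3.add h2))).mul
    continuousAt_const).sub continuousAt_const)

/-- The singular part of the regularised Crandall function is that of the regularised zeta
function. -/
theorem gammaMulPowerFourier_div_Gamma {d : ℕ} (hd : 0 < d) (ν : ℂ)
    (y : EuclideanSpace ℝ (Fin d)) :
    gammaMulPowerFourier d ν y * (Complex.Gamma (ν / 2))⁻¹ = powerFourier d ν y := by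
  rw [gammaMulPowerFourier]
  split_ifs with h
  · obtain ⟨k, rfl⟩ := h
    -- `Complex.Gamma` and its inverse both take the value `0` at the poles, which is the true value
    -- of `1/Γ`; so both sides vanish here.
    have hG : Complex.Gamma (-(2 * k) / 2) = 0 := by
      rw [show (-(2 * k) / 2 : ℂ) = -k by ring]
      exact Complex.Gamma_neg_nat_eq_zero k
    have hne : ¬ ∃ m : ℕ, (-(2 * k) : ℂ) = d + 2 * m := by
      rintro ⟨m, hm⟩
      have : ((d + 2 * k + 2 * m : ℕ) : ℂ) = 0 := by push_cast; linear_combination -hm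
      have := Nat.cast_eq_zero.1 this
      omega
    rw [powerFourier, dif_neg hne, hG]
    simp
  · have hG : Complex.Gamma (ν / 2) ≠ 0 :=
      Complex.Gamma_ne_zero fun m hm => h ⟨m, by linear_combination 2 * hm⟩
    field_simp

/-- Scaling the lattice by `λ⁻¹` scales its dual by `λ` and the reciprocal volume by `λ^d`. The
summand at the origin of the reciprocal lattice is split off, being the one to regularise. -/
theorem crandallSeries_inv_smul {d : ℕ} {A : Matrix (Fin d) (Fin d) ℝ} (hA : A.det ≠ 0)
    (x : EuclideanSpace ℝ (Fin d)) {y : EuclideanSpace ℝ (Fin d)} (hy : y ∉ reciprocalLattice A)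
    {c : ℝ} (hc : 0 < c) (ν : ℂ) :
    crandallSeries (c⁻¹ • A) (c⁻¹ • x) (c • y) ν = directSeries A ν c x y +
      (c : ℂ) ^ d / (cellVolume A : ℂ) *
        (upperCrandall (d - ν) (c • y) + reciprocalSeries A (d - ν) c x y) := by
  have hc0 := hc.ne'
  have hV : ((cellVolume (c⁻¹ • A) : ℝ) : ℂ)⁻¹ = (c : ℂ) ^ d / (cellVolume A : ℂ) := by
    rw [← Complex.ofReal_inv, cellVolume_smul A hc]
    push_cast
    rfl
  have hterm : ∀ n : Fin d → ℤ, puncturedCrandall (d - ν)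
      (latticePoint (c⁻¹ • A)⁻¹.transpose n + c • y) *
        planeWave (c⁻¹ • x) (latticePoint (c⁻¹ • A)⁻¹.transpose n) =
      upperCrandall (d - ν) (c • (latticePoint A⁻¹.transpose n + y)) *
        planeWave x (latticePoint A⁻¹.transpose n) := fun n => by
    rw [inv_smul_transpose hA hc0, latticePoint_smul, ← smul_add, planeWave_comm,
      planeWave_smul_smul_inv hc0, planeWave_comm, puncturedCrandall, if_neg]
    refine smul_ne_zero hc0 fun h => ?_
    exact ne_neg_of_notMem_reciprocalLattice hy n (eq_neg_of_add_eq_zero_left h)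
  have hs : Summable fun n : Fin d → ℤ =>
      upperCrandall (d - ν) (c • (latticePoint A⁻¹.transpose n + y)) *
        planeWave x (latticePoint A⁻¹.transpose n) := by
    refine Summable.of_norm ?_
    have := summable_norm_upperCrandall_smul (det_inv_transpose_ne_zero hA) (-y) hc0 (d - ν)
    simpa only [norm_mul, norm_planeWave, mul_one, sub_neg_eq_add] using this
  rw [crandallSeries, hV]
  simp_rw [hterm]
  rw [hs.tsum_eq_add_tsum_ite 0, latticePoint_zero, zero_add]
  congr 1
  · refine tsum_congr fun n => ?_
    rw [latticePoint_smul, ← smul_sub, planeWave_smul_smul_inv hc0]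
  · congr 2
    simp [planeWave]

theorem sq_div_pi_cpow {c : ℝ} (hc : 0 < c) (ν : ℂ) :
    ((c ^ 2 / Real.pi : ℝ) : ℂ) ^ (-ν / 2) = (c : ℂ) ^ (-ν) * (Real.pi : ℂ) ^ (ν / 2) := by
  rw [ofReal_cpow_eq_exp (by positivity), ofReal_cpow_eq_exp hc, ofReal_cpow_eq_exp Real.pi_pos,
    ← Complex.exp_add, Real.log_div (by positivity) Real.pi_ne_zero, Real.log_pow]
  congr 1
  push_cast
  ring

open Classical in
/-- Crandall's representation of the regularised Epstein zeta function. -/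
theorem epsteinZetaRegAux_eq_crandallRegSeries {d : ℕ} (hd : 0 < d) {A : Matrix (Fin d) (Fin d) ℝ}
    (hA : A.det ≠ 0) (x : EuclideanSpace ℝ (Fin d)) {y : EuclideanSpace ℝ (Fin d)}
    (hy : y ∉ reciprocalLattice A) {c : ℝ} (hc : 0 < c) (ν : ℂ) :
    epsteinZetaRegAux A ν x y = crandallRegSeries A ν c x y := by
  have hy0 : y ≠ 0 := fun h => hy (h ▸ zero_mem_reciprocalLattice A)
  have hc0 : (c : ℂ) ≠ 0 := by exact_mod_cast hc.ne'
  have h1 : Complex.exp (2 * Real.pi * Complex.I * (inner ℝ x y : ℝ)) * planeWave y x = 1 := by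
    rw [← planeWave_neg_right, planeWave_comm y x, mul_comm, planeWave_mul_planeWave_neg]
  have h2 : epsteinEntire A x y ν =
      (c : ℂ) ^ (-ν) * epsteinEntire (c⁻¹ • A) (c⁻¹ • x) (c • y) ν := by
    rw [epsteinEntire_smul hA x hy hc, ← mul_assoc, ← Complex.cpow_add _ _ hc0, neg_add_cancel,
      Complex.cpow_zero, one_mul]
  -- The prefactors `(λ²/π)^(-ν/2)` and `λ^d` cancel the normalisation of the subtracted term in
  -- `G^reg_{d-ν,λ}`, so that `ŝ_ν / V` is recovered exactly.
  have h3 : (c : ℂ) ^ (-ν) * (Real.pi : ℂ) ^ (ν / 2) * ((c : ℂ) ^ d *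
      ((c : ℂ) ^ (-((d : ℂ) - ν)) * (Real.pi : ℂ) ^ (-((d : ℂ) - (d - ν)) / 2))) = 1 := by
    rw [← Complex.cpow_natCast, ofReal_cpow_eq_exp hc, ofReal_cpow_eq_exp hc,
      ofReal_cpow_eq_exp hc, ofReal_cpow_eq_exp Real.pi_pos, ofReal_cpow_eq_exp Real.pi_pos,
      ← Complex.exp_add, ← Complex.exp_add, ← Complex.exp_add, ← Complex.exp_add,
      ← Complex.exp_zero]
    congr 1
    ring
  rw [epsteinZetaRegAux, epsteinZeta_eq hA x hy, ← mul_assoc, h1, one_mul, h2, epsteinEntire,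
    crandallSeries_inv_smul hA x hy hc, crandallRegSeries, upperCrandallReg_of_ne _ _ hy0,
    upperCrandallRegAux, sq_div_pi_cpow hc, ← gammaMulPowerFourier_div_Gamma hd,
    smul_mem_epsteinLattice_smul A (inv_ne_zero hc.ne'), sub_sub_cancel]
  rw [sub_sub_cancel] at h3
  generalize (if x ∈ epsteinLattice A then (Complex.Gamma (ν / 2 + 1))⁻¹ else 0) = e
  linear_combination (1 / (cellVolume A : ℂ)) * gammaMulPowerFourier d ν y *
    (Complex.Gamma (ν / 2))⁻¹ * h3

/-- By discreteness, all nonzero `y` near `0` lie off the reciprocal lattice, where the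
representation holds, and its right-hand side is continuous at `0`. -/
theorem tendsto_epsteinZetaRegAux {d : ℕ} (hd : 0 < d) {A : Matrix (Fin d) (Fin d) ℝ}
    (hA : A.det ≠ 0) (x : EuclideanSpace ℝ (Fin d)) {c : ℝ} (hc : 0 < c) (ν : ℂ) :
    Tendsto (epsteinZetaRegAux A ν x) (𝓝[≠] 0) (𝓝 (crandallRegSeries A ν c x 0)) := by
  refine ((continuousAt_crandallRegSeries hd hA ν hc x).mono_left nhdsWithin_le_nhds).congr' ?_
  obtain ⟨δ, hδ, hle⟩ := exists_le_norm_latticePoint_sub (det_inv_transpose_ne_zero hA) 0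
  filter_upwards [self_mem_nhdsWithin, nhdsWithin_le_nhds (Metric.ball_mem_nhds 0 hδ)]
    with y hy0 hy
  refine (epsteinZetaRegAux_eq_crandallRegSeries hd hA x ?_ hc ν).symm
  rintro ⟨n, rfl⟩
  have := hle n hy0
  rw [sub_zero] at this
  exact absurd (mem_ball_zero_iff.1 hy) (not_lt.2 this)

theorem epsteinZetaReg_eq_crandallRegSeries {d : ℕ} (hd : 0 < d) {A : Matrix (Fin d) (Fin d) ℝ}
    (hA : A.det ≠ 0) (x : EuclideanSpace ℝ (Fin d)) {y : EuclideanSpace ℝ (Fin d)}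
    (hy : y ∉ reciprocalLattice A ∨ y = 0) {c : ℝ} (hc : 0 < c) (ν : ℂ) :
    epsteinZetaReg A ν x y = crandallRegSeries A ν c x y := by
  have := neBot_nhdsNE_zero hd
  rw [epsteinZetaReg]
  split_ifs with h
  · rw [h]
    exact (tendsto_epsteinZetaRegAux hd hA x hc ν).limUnder_eq
  · exact epsteinZetaRegAux_eq_crandallRegSeries hd hA x (hy.resolve_right h) hc ν

/-! ### From sums over `ℤ^d` to sums over lattice points -/

theorem summable_epsteinLattice_iff {d : ℕ} {A : Matrix (Fin d) (Fin d) ℝ} (hA : A.det ≠ 0)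
    (f : EuclideanSpace ℝ (Fin d) → ℂ) :
    (Summable fun z : epsteinLattice A => f z) ↔ Summable fun n => f (latticePoint A n) :=
  ((Equiv.ofInjective _ (latticePoint_injective hA)).summable_iff
    (f := fun z : epsteinLattice A => f z)).symm

theorem tsum_epsteinLattice {d : ℕ} {A : Matrix (Fin d) (Fin d) ℝ} (hA : A.det ≠ 0)
    (f : EuclideanSpace ℝ (Fin d) → ℂ) :
    ∑' z : epsteinLattice A, f z = ∑' n, f (latticePoint A n) :=
  ((Equiv.ofInjective _ (latticePoint_injective hA)).tsum_eq
    (fun z : epsteinLattice A => f z)).symm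

theorem hasSum_reciprocal {d : ℕ} {A : Matrix (Fin d) (Fin d) ℝ} (hA : A.det ≠ 0)
    (x y : EuclideanSpace ℝ (Fin d)) {c : ℝ} (hc : c ≠ 0) (μ : ℂ) :
    HasSum (fun k : ↥(reciprocalLattice A \ {0}) =>
      upperCrandall μ (c • ((k : EuclideanSpace ℝ (Fin d)) + y)) * planeWave x k)
      (reciprocalSeries A μ c x y) := by
  have hB := det_inv_transpose_ne_zero hA
  refine (hasSum_epsteinLattice_diff_iff hB 0
    (fun k => upperCrandall μ (c • (k + y)) * planeWave x k) _).2 ?_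
  have h0 : ∀ n, latticePoint A⁻¹.transpose n - 0 = 0 ↔ n = 0 := fun n => by
    rw [sub_zero, ← latticePoint_zero A⁻¹.transpose]
    exact (latticePoint_injective hB).eq_iff
  simp only [h0]
  refine (Summable.of_norm_bounded (summable_norm_upperCrandall_smul hB (-y) hc μ)
    fun n => ?_).hasSum
  split_ifs
  · rw [norm_zero]; positivity
  · rw [norm_mul, norm_planeWave, mul_one, sub_neg_eq_add]

theorem summable_direct {d : ℕ} {A : Matrix (Fin d) (Fin d) ℝ} (hA : A.det ≠ 0)
    (x y : EuclideanSpace ℝ (Fin d)) {c : ℝ} (hc : c ≠ 0) (ν : ℂ) :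
    Summable fun z : epsteinLattice A =>
      upperCrandall ν (c⁻¹ • ((z : EuclideanSpace ℝ (Fin d)) - x)) *
        planeWave y ((z : EuclideanSpace ℝ (Fin d)) - x) := by
  refine (summable_epsteinLattice_iff hA
    fun z => upperCrandall ν (c⁻¹ • (z - x)) * planeWave y (z - x)).2 (Summable.of_norm ?_)
  simpa only [norm_mul, norm_planeWave, mul_one] using
    summable_norm_upperCrandall_smul hA x (inv_ne_zero hc) ν

open Classical in
theorem tsum_direct {d : ℕ} {A : Matrix (Fin d) (Fin d) ℝ} (hA : A.det ≠ 0)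
    (x y : EuclideanSpace ℝ (Fin d)) {c : ℝ} (hc : c ≠ 0) (ν : ℂ) :
    ∑' z : epsteinLattice A, upperCrandall ν (c⁻¹ • ((z : EuclideanSpace ℝ (Fin d)) - x)) *
        planeWave y ((z : EuclideanSpace ℝ (Fin d)) - x) =
      directSeries A ν c x y + if x ∈ epsteinLattice A then -2 / ν else 0 := by
  have h := tsum_upperCrandall_eq (det_smul_ne_zero hA (inv_ne_zero hc)) (c⁻¹ • x) (c • y) ν
  simp only [latticePoint_smul, ← smul_sub, planeWave_smul_smul_inv hc,
    smul_mem_epsteinLattice_smul A (inv_ne_zero hc)] at h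
  rw [tsum_epsteinLattice hA fun z => upperCrandall ν (c⁻¹ • (z - x)) * planeWave y (z - x), h,
    directSeries]

/-- The excluded case is the one where `-2/ν` is a division by zero: the summand at `z = x` would
then contribute `0` instead of its limit `-1`. -/
theorem crandallRegSeries_eq {d : ℕ} {A : Matrix (Fin d) (Fin d) ℝ} (hA : A.det ≠ 0)
    (x y : EuclideanSpace ℝ (Fin d)) {c : ℝ} (hc : c ≠ 0) {ν : ℂ}
    (h : ν ≠ 0 ∨ x ∉ epsteinLattice A) :
    crandallRegSeries A ν c x y =
      ((c ^ 2 / Real.pi : ℝ) : ℂ) ^ (-ν / 2) / Complex.Gamma (ν / 2) *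
        (∑' z : epsteinLattice A, upperCrandall ν (c⁻¹ • ((z : EuclideanSpace ℝ (Fin d)) - x)) *
            planeWave y ((z : EuclideanSpace ℝ (Fin d)) - x)
          + (c : ℂ) ^ d / (cellVolume A : ℂ) *
            (upperCrandallReg (d - ν) c y
              + ∑' k : ↥(reciprocalLattice A \ {0}),
                  upperCrandall (d - ν) (c • ((k : EuclideanSpace ℝ (Fin d)) + y)) *
                    planeWave x k)) := by
  rw [tsum_direct hA x y hc, (hasSum_reciprocal hA x y hc _).tsum_eq, crandallRegSeries]
  split_ifs with hx
  · rw [← one_div_two_mul_Gamma_inv (h.resolve_right (not_not.2 hx))]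
    ring
  · ring

/-- At `ν = 0` the factor `1/Γ(0) = 0` removes both series, leaving `-1/Γ(1)` from `z = x`. -/
theorem crandallRegSeries_zero {d : ℕ} {A : Matrix (Fin d) (Fin d) ℝ}
    {x : EuclideanSpace ℝ (Fin d)} (hx : x ∈ epsteinLattice A) (y : EuclideanSpace ℝ (Fin d))
    (c : ℝ) : crandallRegSeries A 0 c x y = -1 := by
  rw [crandallRegSeries, if_pos hx]
  simp

theorem tsum_poleSeriesTerm_subtype (k : ℕ) (X : ℝ) :
    ∑' n : {n : ℕ // n ≠ k}, poleSeriesTerm k X n = ∑' n, poleSeriesTerm k X n := by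
  refine tsum_subtype_eq_of_support_subset (s := {n : ℕ | n ≠ k}) fun n hn => ?_
  rintro rfl
  exact hn (poleSeriesTerm_self _ X)

end

/-! ### Assembly of the theorem -/

theorem mainTheorem4 {d : ℕ} (hd : 0 < d) (A : Matrix (Fin d) (Fin d) ℝ) (hA : A.det ≠ 0)
    (x : EuclideanSpace ℝ (Fin d)) (ν : ℂ) (lam : ℝ) (hlam : 0 < lam) :
    -- the continuations and continuous extensions in the definitions exist
    (∀ y : EuclideanSpace ℝ (Fin d), y ∉ reciprocalLattice A →
      IsEpsteinContinuation A x y (fun μ => epsteinZeta A μ x y)) ∧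
    Tendsto (epsteinZetaRegAux A ν x) (𝓝[≠] 0) (𝓝 (epsteinZetaReg A ν x 0)) ∧
    Tendsto (upperCrandallRegAux (d := d) ν lam) (𝓝[≠] 0)
      (𝓝 (upperCrandallReg (d := d) ν lam 0)) ∧
    -- the representation of the regularised Epstein zeta function
    (∀ y : EuclideanSpace ℝ (Fin d), y ∉ reciprocalLattice A ∨ y = 0 →
      Summable (fun z : epsteinLattice A =>
        upperCrandall ν ((1 / lam) • ((z : EuclideanSpace ℝ (Fin d)) - x))
          * Complex.exp (-(2 * Real.pi * Complex.I * (inner ℝ y (z - x) : ℝ)))) ∧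
      Summable (fun k : ↥(reciprocalLattice A \ {0}) =>
        upperCrandall (d - ν) (lam • ((k : EuclideanSpace ℝ (Fin d)) + y))
          * Complex.exp (-(2 * Real.pi * Complex.I *
              (inner ℝ x (k : EuclideanSpace ℝ (Fin d)) : ℝ)))) ∧
      (ν ≠ 0 ∨ x ∉ epsteinLattice A →
        epsteinZetaReg A ν x y =
          ((lam ^ 2 / Real.pi : ℝ) : ℂ) ^ (-ν / 2) / Complex.Gamma (ν / 2) *
            (∑' z : epsteinLattice A,
                upperCrandall ν ((1 / lam) • ((z : EuclideanSpace ℝ (Fin d)) - x))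
                  * Complex.exp (-(2 * Real.pi * Complex.I * (inner ℝ y (z - x) : ℝ)))
              + (lam : ℂ) ^ d / (cellVolume A : ℂ) *
                (upperCrandallReg (d - ν) lam y
                  + ∑' k : ↥(reciprocalLattice A \ {0}),
                      upperCrandall (d - ν) (lam • ((k : EuclideanSpace ℝ (Fin d)) + y))
                        * Complex.exp (-(2 * Real.pi * Complex.I *
                            (inner ℝ x (k : EuclideanSpace ℝ (Fin d)) : ℝ)))))) ∧
      -- for `ν = 0` and `x ∈ Λ` the summand `z = x` is read as `lim G_ν(0) / Γ(ν/2) = -1`,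
      -- and all the other terms vanish because of the factor `1 / Γ(ν/2)`
      (ν = 0 → x ∈ epsteinLattice A → epsteinZetaReg A ν x y = -1)) ∧
    -- the regularised Crandall function at generic exponents
    ((¬ ∃ k : ℕ, ν = -(2 * k)) →
      ∀ y : EuclideanSpace ℝ (Fin d), upperCrandallReg ν lam y = -lowerCrandall ν (lam • y)) ∧
    -- the regularised Crandall function at the exceptional exponents
    (∀ k : ℕ, ν = -(2 * k) → ∀ y : EuclideanSpace ℝ (Fin d),
      Summable (fun n : {n : ℕ // n ≠ k} =>
        (-(Real.pi * lam ^ 2 * ‖y‖ ^ 2)) ^ (n : ℕ)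
          / (((n : ℕ) - k : ℝ) * ((n : ℕ).factorial : ℝ))) ∧
      upperCrandallReg ν lam y =
        (((-1) ^ k / (k.factorial : ℝ)
            * ((harmonic k : ℝ) - Real.eulerMascheroniConstant - Real.log (lam ^ 2))
            * (Real.pi * lam ^ 2 * ‖y‖ ^ 2) ^ k
          - ∑' n : {n : ℕ // n ≠ k},
              (-(Real.pi * lam ^ 2 * ‖y‖ ^ 2)) ^ (n : ℕ)
                / (((n : ℕ) - k : ℝ) * ((n : ℕ).factorial : ℝ)) : ℝ) : ℂ)) := by
  refine ⟨fun y hy => isEpsteinContinuation_epsteinZeta hA x hy, ?_,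
    tendsto_upperCrandallRegAux hd ν hlam, fun y hy => ⟨?_, ?_, fun h => ?_, fun hν hx => ?_⟩,
    fun hν y => upperCrandallReg_of_generic hd hν hlam y, fun k hk y => ⟨?_, ?_⟩⟩
  · rw [epsteinZetaReg_eq_crandallRegSeries hd hA x (Or.inr rfl) hlam]
    exact tendsto_epsteinZetaRegAux hd hA x hlam ν
  · rw [one_div]
    exact summable_direct hA x y hlam.ne' ν
  · exact (hasSum_reciprocal hA x y hlam.ne' (d - ν)).summable
  · rw [epsteinZetaReg_eq_crandallRegSeries hd hA x hy hlam,
      crandallRegSeries_eq hA x y hlam.ne' h, one_div]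
    rfl
  · rw [epsteinZetaReg_eq_crandallRegSeries hd hA x hy hlam, hν, crandallRegSeries_zero hx]
  · exact (summable_poleSeriesTerm k (Real.pi * lam ^ 2 * ‖y‖ ^ 2)).subtype _
  · have h := tsum_poleSeriesTerm_subtype k (Real.pi * lam ^ 2 * ‖y‖ ^ 2)
    simp only [poleSeriesTerm] at h
    rw [hk, upperCrandallReg_of_exceptional hd k hlam, h]
    rfl
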